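/- **Setting.** An ADMG $G$ on a finite node set $V$ consists of a set of directed edges $u\to v$ and a set of bidirected edges $u\leftrightarrow v$ ($u\ne v$), without directed cycle; $p=|V|$ and $m$ is the total number of edges. On a walk, an interior node is a *collider* if both incident walk edges have an arrowhead at it, and a *non-collider* otherwise. A walk is *open given* $Z$ if all its colliders are in $Z$ and none of its non-colliders is in $Z$; $X\perp_G Y\mid Z$ means that no walk from $X$ to $Y$ is open given $Z$. A node is an ancestor and a descendant of itself, $\mathrm{an}_G(X)$ and $\mathrm{de}_G(X)$ are the sets of ancestors and descendants of nodes of $X$. For distinct nodes $x,y$, let $\mathrm{causal}_G(x,y)$ be the set of descendants of $x$ that have a directed path to $y$ not containing $x$, let $\mathrm{forb}_G(x,y)=\mathrm{de}_G(\mathrm{causal}_G(x,y))\cup\{x\}$, and let $\tilde G$ be $G$ without the edges $x\to c$, $c\in\mathrm{causal}_G(x,y)$. A pair $(z,W)$, $z \in V$, $W\subseteq V$, is a *valid conditional instrumental set relative to* $(x,y)$ if $\{x,y\},\{z\},W$ are pairwise disjoint, $(\{z\}\cup W)\cap\mathrm{forb}_G(x,y)=\emptyset$, $x\not\perp_G z\mid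 W$ and $y\perp_{\tilde G}z\mid W$. For a set $R$ disjoint from $\{y,z\}$, a set $W\subseteq R\cap \mathrm{an}_{G}(\{y,z\})$ is a *nearest separator* with respect to $y,z,R$ in $G$ if $y\perp_{G}z\mid W$ and, for all $w\in W$ and $W'\subseteq (R\cap\mathrm{an}_{G}(\{y,z\}))\setminus\{w\}$, $w\not\perp_{G}z\mid W'$ implies $y\not\perp_{G}z\mid W'$. Let $\mathrm{closure}_G(a,Z,A)$ be the set of nodes $v$ reachable from $a$ by a path that only contains nodes of $A$ and no non-collider in $Z$. **Algorithm.** The subroutine $\mathrm{nearestSeparator}(G,a,b,R)$ puts $A=\mathrm{an}_G(\{a,b\})$, $Z_0=(R\cap A)\setminus\{a,b\}$, $S=\mathrm{closure}_G(a,Z_0,A)$, and returns $\bot$ if $b\in S$ and $Z_0\cap S$ otherwise. The algorithm goes through the nodes $z\in V\setminus(\mathrm{forb}_G(x,y)\cup\{y\})$, computes $W=\mathrm{nearestSeparator}(\tilde G,y,z,V\setminus\mathrm{forb}_G(x,y))$, and returns $(z,W)$ as soon as $W\neq\bot$ and $x\not\perp_G z\mid W$; if this never happens it returns $\bot$. Ancestors,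 descendants, closures and the nodes d-connected to $x$ given $W$ are computed by depth-first search over states (node, type of the last edge); the input is given by adjacency lists, in any order, and running time is the number of elementary steps of a unit-cost random-access machine. **Theorem.** Let $x$ and $y$ be distinct nodes in an ADMG $G$. If there is a valid conditional instrumental set $(z,W)$ relative to $(x,y)$ in $G$, then the algorithm returns one, and the returned $W$ is a nearest separator with respect to $y$, $z$ and $V\setminus(\mathrm{forb}_G(x,y)\cup\{y,z\})$ in $\tilde G$. If there is none, the algorithm returns $\bot$. The algorithm runs in time $O(p\cdot(p+m))$, with a constant that does not depend on $G$, $x$, $y$. -/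

import Mathlib

/-! ### Acyclic directed mixed graphs -/

/-- The three neighbour types of a mixed graph: a node `v` is reached from `u` along
`u → v` (`fwd`), `u ← v` (`bwd`) or `u ↔ v` (`bi`). -/
inductive Nbr where
  | fwd
  | bwd
  | bi
  deriving DecidableEq

/-- `u` entered through `n` and left through `n'` is a collider: both edges have an
arrowhead at `u`. -/
def Nbr.collider : Nbr → Nbr → Bool
  | .fwd, .bwd => true
  | .fwd, .bi => true
  | .bi, .bwd => true
  | .bi, .bi => true
  | _, _ => false

/-- An acyclic directed mixed graph: directed edges are ordered pairs, bidirected edges are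
unordered pairs of distinct nodes, and there is no directed cycle. -/
structure ADMG (V : Type) where
  dirEdges : Finset (V × V)
  biEdges : Finset (Sym2 V)
  biEdges_not_isDiag : ∀ e ∈ biEdges, ¬ e.IsDiag
  acyclic : ∀ v, ¬ Relation.TransGen (fun a b => (a, b) ∈ dirEdges) v v

namespace ADMG

variable {V : Type}

/-- The number `m` of edges. -/
def numEdges (G : ADMG V) : ℕ := G.dirEdges.card + G.biEdges.card

/-- `G.Adj u n v`: there is an edge of type `n` from `u` to `v`. -/
def Adj (G : ADMG V) (u : V) : Nbr → V → Prop
  | .fwd, v => (u, v) ∈ G.dirEdges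
  | .bwd, v => (v, u) ∈ G.dirEdges
  | .bi, v => s(u, v) ∈ G.biEdges

/-- Walks: sequences of consecutive edges, with their types and orientations. -/
inductive Walk (G : ADMG V) : V → V → Type
  | nil (v : V) : Walk G v v
  | cons {u v w : V} (n : Nbr) (h : G.Adj u n v) (p : Walk G v w) : Walk G u w

/-- The remaining part `p` of a walk is open given `Z`, where the first node of `p` was entered
through an edge of type `n`: every collider is in `Z` and every non-collider is not in `Z`. -/
def Walk.IsOpenAfter {G : ADMG V} (Z : Set V) : {u w : V} → Nbr → G.Walk u w → Prop
  | _, _, _, .nil _ => True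
  | u, _, n, .cons n' _ p =>
      (if n.collider n' then u ∈ Z else u ∉ Z) ∧ p.IsOpenAfter Z n'

/-- A walk is open given `Z` if all its colliders are in `Z` and all its non-colliders (interior
nodes that are not colliders) are outside `Z`. -/
def Walk.IsOpen {G : ADMG V} (Z : Set V) : {u w : V} → G.Walk u w → Prop
  | _, _, .nil _ => True
  | _, _, .cons n _ p => p.IsOpenAfter Z n

/-- `X` and `Y` are d-separated given `Z`: there is no open walk between them. -/
def DSep (G : ADMG V) (X Y Z : Set V) : Prop :=
  ∀ x ∈ X, ∀ y ∈ Y, ∀ w : G.Walk x y, ¬ w.IsOpen Z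

/-- Nodes with a directed path to some node of `X`. -/
def ancestors (G : ADMG V) (X : Set V) : Set V :=
  {v | ∃ x ∈ X, Relation.ReflTransGen (fun a b => (a, b) ∈ G.dirEdges) v x}

/-- Nodes reached by a directed path from some node of `X`. -/
def descendants (G : ADMG V) (X : Set V) : Set V :=
  {v | ∃ x ∈ X, Relation.ReflTransGen (fun a b => (a, b) ∈ G.dirEdges) x v}

/-- Nodes with a directed path to some node of `Y`, no node of the path being in `W`. -/
def properAncestors (G : ADMG V) (W Y : Set V) : Set V :=
  {v | ∃ y ∈ Y, y ∉ W ∧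
    Relation.ReflTransGen (fun a b => (a, b) ∈ G.dirEdges ∧ a ∉ W) v y}

/-- The causal nodes relative to `(x, y)`. -/
def causal (G : ADMG V) (x y : V) : Set V :=
  G.properAncestors {x} {y} ∩ G.descendants {x}

/-- The forbidden nodes relative to `(x, y)`. -/
def forb (G : ADMG V) (x y : V) : Set V :=
  G.descendants (G.causal x y) ∪ {x}

open Classical in
/-- `G` without the directed edges from `x` to causal nodes relative to `(x, y)`. -/
noncomputable def cutCausal (G : ADMG V) (x y : V) : ADMG V where
  dirEdges := G.dirEdges.filter fun e => ¬ (e.1 = x ∧ e.2 ∈ G.causal x y)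
  biEdges := G.biEdges
  biEdges_not_isDiag := G.biEdges_not_isDiag
  acyclic v h := G.acyclic v (Relation.TransGen.mono (fun _ _ hab => (Finset.mem_filter.1 hab).1) _ _ h)

/-- `(Z, W)` is a valid conditional instrumental set relative to `(x, y)` (graphical
criterion). -/
structure IsValidCIS (G : ADMG V) (x y : V) (Z W : Set V) : Prop where
  ne : x ≠ y
  disjoint_Z : Disjoint {x, y} Z
  disjoint_W : Disjoint {x, y} W
  disjoint_ZW : Disjoint Z W
  forb_disjoint : Disjoint (Z ∪ W) (G.forb x y)
  not_dSep : ¬ G.DSep {x} Z W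
  dSep_cut : (G.cutCausal x y).DSep {y} Z W

/-- `W` is a nearest separator with respect to `y`, `z` and a node set `R` (disjoint from
`{y, z}`). -/
structure IsNearestSeparator (G : ADMG V) (y z : V) (R W : Set V) : Prop where
  subset : W ⊆ R ∩ G.ancestors {y, z}
  dSep : G.DSep {y} {z} W
  nearest : ∀ w ∈ W, ∀ W' ⊆ (R ∩ G.ancestors {y, z}) \ {w},
    ¬ G.DSep {w} {z} W' → ¬ G.DSep {y} {z} W'

end ADMG

/-! ### Step-counted computations

A computation in the unit-cost random-access model. Nodes, neighbour types and truth values are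
machine words, nodes serve as array addresses, and arrays are functions that are only accessed
through `Timed.read`, `Timed.write` and `Timed.newArray`. Each elementary operation (array
access, comparison, taking an element off a list or putting one on, an iteration of a loop)
costs one step, and a new array costs as many steps as it has cells. Branching on the result of an
elementary operation and returning a result are free. -/

/-- A result together with the number of elementary steps spent on it. -/
structure Timed (α : Type) where
  val : α
  steps : ℕ

namespace Timed

instance : Monad Timed where
  pure a := ⟨a, 0⟩
  bind t f := ⟨(f t.val).val, t.steps + (f t.val).steps⟩

/-- One elementary operation with result `a`. -/
def step {α : Type} (a : α) : Timed α := ⟨a, 1⟩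

/-- Array access. -/
def read {ι β : Type} (a : ι → β) (i : ι) : Timed β := step (a i)

/-- Array update. -/
def write {ι β : Type} [DecidableEq ι] (a : ι → β) (i : ι) (b : β) : Timed (ι → β) :=
  step (Function.update a i b)

/-- A new array of `k` cells, all holding `b`. -/
def newArray {ι β : Type} (k : ℕ) (b : β) : Timed (ι → β) := ⟨fun _ => b, k⟩

/-- Comparison of two words. -/
def isEq {α : Type} [DecidableEq α] (a b : α) : Timed Bool := step (decide (a = b))

/-- Loop over a list, updating a state. -/
def forEach {α σ : Type} : List α → σ → (σ → α → Timed σ) → Timed σ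
  | [], s, _ => step s
  | a :: l, s, f => do
      let a ← step a
      let s ← f s a
      forEach l s f

end Timed

/-- Adjacency-list input: the list of nodes, and for each neighbour type an array of neighbour
lists. -/
structure AdjLists (V : Type) where
  nodes : List V
  nbrs : Nbr → V → List V

namespace AdjLists

variable {V : Type}

/-- `g` is an adjacency-list representation of `G`; the order of the lists is arbitrary. -/
structure Represents (g : AdjLists V) (G : ADMG V) : Prop where
  nodup_nodes : g.nodes.Nodup
  mem_nodes : ∀ v, v ∈ g.nodes
  nodup_nbrs : ∀ n v, (g.nbrs n v).Nodup
  mem_nbrs : ∀ n v u, u ∈ g.nbrs n v ↔ G.Adj v n u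

end AdjLists

namespace Algo

open Timed

variable {V : Type} [DecidableEq V]

/-! ### Reachability in the state space -/

/-- A search state: the states marked as visited, and the stack of marked states whose
successors have not been generated yet. -/
structure Search (V : Type) where
  visited : V × Nbr → Bool
  stack : List (V × Nbr)

/-- Mark the state `t` as visited and put it on the stack, unless it is already marked. -/
def visit (st : Search V) (t : V × Nbr) : Timed (Search V) := do
  if ← read st.visited t then
    return st
  else
    let visited ← write st.visited t true
    let stack ← step (t :: st.stack)
    return ⟨visited, stack⟩

/-- Visit all states `(v₂, n₂)` such that `v₂` is a neighbour of type `n₂` of the node of `s` and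
the transition is allowed by `φ`. -/
def expand (g : AdjLists V) (φ : V × Nbr → V × Nbr → Timed Bool) (st : Search V)
    (s : V × Nbr) : Timed (Search V) :=
  forEach [Nbr.fwd, Nbr.bwd, Nbr.bi] st fun st n => do
    let l ← read (g.nbrs n) s.1
    forEach l st fun st v => do
      if ← φ s (v, n) then visit st (v, n) else return st

/-- Expand states from the stack until it is empty, at most `k` times. -/
def searchLoop (g : AdjLists V) (φ : V × Nbr → V × Nbr → Timed Bool) :
    ℕ → Search V → Timed (Search V)
  | 0, st => step st
  | k + 1, st => do
      match ← step st.stack with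
      | [] => return st
      | s :: rest =>
          let st ← expand g φ ⟨st.visited, rest⟩ s
          searchLoop g φ k st

/-- The node set (as a Boolean array) given by a test that is run on every node. -/
def tabulate (g : AdjLists V) (f : V → Timed Bool) : Timed (V → Bool) := do
  let a ← newArray g.nodes.length false
  forEach g.nodes a fun a v => do
    let b ← f v
    write a v b

/-- Depth-first search in the state-space graph on `V × Nbr` with transitions given by `φ`, from
the states `(v, n₀)`, `v ∈ X`; returns the nodes of all visited states. Each of the `3 p` states
is put on the stack at most once. -/
def reach (g : AdjLists V) (X : List V) (n₀ : Nbr) (φ : V × Nbr → V × Nbr → Timed Bool) :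
    Timed (V → Bool) := do
  let visited ← newArray (3 * g.nodes.length) false
  let st ← forEach X ⟨visited, []⟩ fun st v => visit st (v, n₀)
  let st ← searchLoop g φ (3 * g.nodes.length) st
  tabulate g fun v => do
    let a ← read st.visited (v, .fwd)
    let b ← read st.visited (v, .bwd)
    let c ← read st.visited (v, .bi)
    step (a || b || c)

/-- Nodes reachable along `→`. -/
def descendants (g : AdjLists V) (X : List V) : Timed (V → Bool) :=
  reach g X .fwd fun _ t => isEq t.2 .fwd

/-- Nodes reachable along `←`. -/
def ancestors (g : AdjLists V) (X : List V) : Timed (V → Bool) :=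
  reach g X .bwd fun _ t => isEq t.2 .bwd

/-- Nodes reachable along `←` without entering `x`. -/
def properAncestors (g : AdjLists V) (x : V) (Y : List V) : Timed (V → Bool) :=
  reach g Y .bwd fun _ t => do
    if ← isEq t.2 .bwd then
      let b ← isEq t.1 x
      return !b
    else
      return false

/-- All nodes d-connected to `x` given `Z`. -/
def dConnected (g : AdjLists V) (x : V) (Z : V → Bool) : Timed (V → Bool) :=
  reach g [x] .bwd fun s t => do
    let b ← read Z s.1
    if ← step (s.2.collider t.2) then return b else return !b

/-- All nodes reachable from `x` by a path in `A` without non-collider in `Z`. -/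
def closure (g : AdjLists V) (x : V) (Z A : V → Bool) : Timed (V → Bool) :=
  reach g [x] .bwd fun s t => do
    let a ← read A t.1
    if ← step (s.2.collider t.2) then
      return a
    else
      let b ← read Z s.1
      step (a && !b)

/-! ### The algorithm -/

/-- The causal nodes relative to `(x, y)`. -/
def causal (g : AdjLists V) (x y : V) : Timed (V → Bool) := do
  let a ← properAncestors g x [y]
  let d ← descendants g [x]
  tabulate g fun v => do
    let b ← read a v
    let c ← read d v
    step (b && c)

/-- The elements of a node set, as a list. -/
def elements (g : AdjLists V) (S : V → Bool) : Timed (List V) :=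
  forEach g.nodes [] fun l v => do
    if ← read S v then step (v :: l) else return l

/-- The forbidden nodes relative to `(x, y)`, given the causal nodes `C`. -/
def forb (g : AdjLists V) (x : V) (C : V → Bool) : Timed (V → Bool) := do
  let l ← elements g C
  let d ← descendants g l
  write d x true

/-- The elements of a list that pass a test. -/
def select (l : List V) (f : V → Timed Bool) : Timed (List V) :=
  forEach l [] fun r u => do
    if ← f u then step (u :: r) else return r

/-- Delete the edges from `x` to nodes of `C`. -/
def cutCausal (g : AdjLists V) (x : V) (C : V → Bool) : Timed (AdjLists V) := do
  let ch ← newArray g.nodes.length []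
  let ch ← forEach g.nodes ch fun ch v => do
    let l ← read (g.nbrs .fwd) v
    let l ← select l fun u => do
      let b ← isEq v x
      let c ← read C u
      step (!(b && c))
    write ch v l
  let pa ← newArray g.nodes.length []
  let pa ← forEach g.nodes pa fun pa v => do
    let l ← read (g.nbrs .bwd) v
    let l ← select l fun u => do
      let b ← isEq u x
      let c ← read C v
      step (!(b && c))
    write pa v l
  return ⟨g.nodes, fun
    | .fwd => ch
    | .bwd => pa
    | .bi => g.nbrs .bi⟩

/-- With `A` the ancestors of `{a, b}` and `Z₀ = (R ∩ A) \ {a, b}`, compute the closure `S` of `a`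
relative to `Z₀` and `A`; return `none` if it contains `b`, and `Z₀ ∩ S` otherwise. -/
def nearestSeparator (g : AdjLists V) (a b : V) (R : V → Bool) : Timed (Option (V → Bool)) := do
  let A ← ancestors g [a, b]
  let Z₀ ← tabulate g fun v => do
    let r ← read R v
    let c ← read A v
    let d ← isEq v a
    let e ← isEq v b
    step (r && c && !d && !e)
  let S ← closure g a Z₀ A
  if ← read S b then
    return none
  else
    let W ← tabulate g fun v => do
      let c ← read Z₀ v
      let d ← read S v
      step (c && d)
    return some W

/-- Try the candidates `z` of a list one after the other; `F` is the set of forbidden nodes, `R`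
its complement, and `g'` the graph without the edges from `x` to causal nodes. -/
def tryAll (g g' : AdjLists V) (x y : V) (F R : V → Bool) :
    List V → Timed (Option (V × (V → Bool)))
  | [] => step none
  | z :: rest => do
      let z ← step z
      let f ← read F z
      let e ← isEq z y
      if f || e then
        tryAll g g' x y F R rest
      else
        match ← nearestSeparator g' y z R with
        | none => tryAll g g' x y F R rest
        | some W =>
            let D ← dConnected g x W
            if ← read D z then
              return some (z, W)
            else
              tryAll g g' x y F R rest

/-- For each node `z` that is neither forbidden nor `y`, compute a nearest separator `W` of `y` and
`z` among the non-forbidden nodes in the graph without the edges from `x` to causal nodes; return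
the first `(z, W)` such that `x` and `z` are d-connected given `W`, and `none` if there is none. -/
def findInstrument (g : AdjLists V) (x y : V) : Timed (Option (V × (V → Bool))) := do
  let C ← causal g x y
  let F ← forb g x C
  let R ← tabulate g fun v => do
    let b ← read F v
    step (!b)
  let g' ← cutCausal g x C
  tryAll g g' x y F R g.nodes

end Algo

/-!
Walks are handled as paths in the state space of the search: a state `(v, n)` records the current
node and the type of the edge through which it was entered, and whether the next edge may be taken
depends on that alone (`ADMG.Step`). `ADMG.DConn` is d-connection in this form.

The graph theory rests on one rerouting argument, `ADMG.reach_or_dConn_of_colliders`: a walk whose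
non-colliders avoid `Z` need not have its colliders in `Z`. A collider that is an ancestor of `Z`
can be replaced by a detour into `Z` and back, one that is an ancestor of the start by a directed
path from it to the start; and if it is an ancestor of some further set `E`, a directed path leads
to `E`. Consequently, if some separator of `y` and `z` lies in `R ∩ an {y, z}`, the closure of `y` does
not reach `z`, and its intersection with `R ∩ an {y, z}` is a nearest separator `N`
(`ADMG.notMem_closure_of_not_dConn`, `ADMG.isNearestSeparator_closure`).

If `(z, W)` is an instrument with `W ⊆ an {y, z}`, so is `(z, N)`: on an open walk given `W` no
non-collider is in `N`, since it would be connected to `z` given `W`, and then so would `y`; the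
colliders are ancestors of `y` or `z`, and rerouting connects `z` with `x`, because it cannot
connect `z` with `y` (`ADMG.dConn_of_isNearestSeparator`). An arbitrary instrument `(z, W)` yields an
ancestral one, possibly with another node: take the first collider `c ∉ an y` on an open walk from
`x` to `z` as the new instrument. An open walk from `y` to `c` among ancestors of `y` and `c` has to
enter `c` through an arrowhead, so it could be continued to `z`
(`ADMG.exists_ancestral_instrument`). Finally, deleting the causal edges does not affect the
connections of `x` with non-forbidden nodes (`ADMG.dConn_cutCausal_iff`), so that all of this can be
done in the cut graph.

For the programs, `Algo.Adds` describes what visiting a set of states does to a search. Every state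
is put on the stack at most once, so the total weight of the states that are unmarked or on the
stack (`Algo.potential`) bounds both the number of rounds and, with expansion costs as weights, the
running time. Each search takes `O(p + m)` steps, and there are at most three per candidate node.
-/

/-! ### Open walks as paths between states -/

@[simp] lemma Nbr.collider_bwd_left (n : Nbr) : Nbr.collider .bwd n = false := by
  cases n <;> rfl

@[simp] lemma Nbr.collider_fwd_right (n : Nbr) : Nbr.collider n .fwd = false := by
  cases n <;> rfl

/-- Whether a step through `n'` makes a collider does not depend on which of the two arrowhead
types was used to enter. -/
lemma Nbr.collider_of_ne_bwd {m m' n : Nbr} (h : m.collider n = true) (hm : m' ≠ .bwd) :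
    m'.collider n = true := by
  cases m <;> cases m' <;> cases n <;> simp_all [Nbr.collider]

lemma Nbr.eq_fwd_of_not_collider {m n : Nbr} (h : m.collider n = false) (hm : m ≠ .bwd) :
    n = .fwd := by
  cases m <;> cases n <;> simp_all [Nbr.collider]

/-- The neighbour type of an edge traversed in the opposite direction. -/
def Nbr.rev : Nbr → Nbr
  | .fwd => .bwd
  | .bwd => .fwd
  | .bi => .bi

lemma Nbr.collider_rev (m n : Nbr) : Nbr.collider n.rev m.rev = Nbr.collider m n := by
  cases m <;> cases n <;> rfl

lemma Relation.ReflTransGen.imp {α : Type*} {r q : α → α → Prop} {s t : α}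
    (h : Relation.ReflTransGen r s t) (H : ∀ a b, r a b → q a b) : Relation.ReflTransGen q s t :=
  Relation.ReflTransGen.mono H _ _ h

open Relation in
/-- Along a chain of `r`-steps, either all steps are `q`-steps, or there is a first one that is
not. -/
lemma Relation.ReflTransGen.all_or_first_not {α : Type*} {r : α → α → Prop} (q : α → α → Prop)
    {s t : α} (h : ReflTransGen r s t) :
    ReflTransGen (fun a b => r a b ∧ q a b) s t ∨
      ∃ u v, ReflTransGen (fun a b => r a b ∧ q a b) s u ∧ r u v ∧ ¬ q u v ∧
        ReflTransGen r v t := by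
  induction h with
  | refl => exact .inl .refl
  | tail _ hbc ih =>
    rename_i b c _
    rcases ih with ih | ⟨u, v, h₁, h₂, h₃, h₄⟩
    · by_cases hq : q b c
      · exact .inl (ih.tail ⟨hbc, hq⟩)
      · exact .inr ⟨b, c, ih, hbc, hq, .refl⟩
    · exact .inr ⟨u, v, h₁, h₂, h₃, h₄.tail hbc⟩

namespace ADMG

open Relation

section

variable {V : Type} {G : ADMG V}

/-- `u → v`. -/
abbrev Dir (G : ADMG V) (u v : V) : Prop := (u, v) ∈ G.dirEdges

/-- Transitions between states `(v, n)`, "the walk is at `v` and has entered it through an edge of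
type `n`". A node may be passed as a collider if it is in `C`, and as a non-collider if it is not
in `D`. -/
def Step (G : ADMG V) (C D : Set V) (s t : V × Nbr) : Prop :=
  G.Adj s.1 t.2 t.1 ∧ if s.2.collider t.2 then s.1 ∈ C else s.1 ∉ D

/-- Reachability of `b` from `a` by a walk that is open given `Z`. The start state `(a, bwd)` makes
`a` a non-collider, so this is meant for `a ∉ Z`. -/
def DConn (G : ADMG V) (Z : Set V) (a b : V) : Prop :=
  ∃ k, ReflTransGen (G.Step Z Z) (a, .bwd) (b, k)

lemma Step.mono {C D C' D' : Set V} (hC : C ⊆ C') (hD : D' ⊆ D) {s t : V × Nbr}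
    (h : G.Step C D s t) : G.Step C' D' s t := by
  refine ⟨h.1, ?_⟩
  have h2 := h.2
  split_ifs at h2 ⊢ with hc
  · exact hC h2
  · exact fun h => h2 (hD h)

lemma step_of_collider {C D : Set V} {u v : V} {n n' : Nbr} (ha : G.Adj u n' v)
    (hc : n.collider n' = true) (hu : u ∈ C) : G.Step C D (u, n) (v, n') :=
  ⟨ha, by simpa [hc] using hu⟩

lemma step_of_not_collider {C D : Set V} {u v : V} {n n' : Nbr} (ha : G.Adj u n' v)
    (hc : n.collider n' = false) (hu : u ∉ D) : G.Step C D (u, n) (v, n') :=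
  ⟨ha, by simpa [hc] using hu⟩

lemma exists_isOpenAfter_iff {Z : Set V} {u w : V} {n : Nbr} :
    (∃ p : G.Walk u w, p.IsOpenAfter Z n) ↔
      ∃ k, ReflTransGen (G.Step Z Z) (u, n) (w, k) := by
  constructor
  · rintro ⟨p, hp⟩
    induction p generalizing n with
    | nil v => exact ⟨n, .refl⟩
    | cons n' h p ih =>
      obtain ⟨k, hk⟩ := ih hp.2
      exact ⟨k, hk.head ⟨h, hp.1⟩⟩
  · rintro ⟨k, hk⟩
    have key : ∀ s : V × Nbr, ReflTransGen (G.Step Z Z) s (w, k) →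
        ∃ p : G.Walk s.1 w, p.IsOpenAfter Z s.2 := by
      intro s hs
      induction hs using ReflTransGen.head_induction_on with
      | refl => exact ⟨.nil w, trivial⟩
      | head hst _ ih =>
        obtain ⟨p, hp⟩ := ih
        exact ⟨.cons _ hst.1 p, hst.2, hp⟩
    exact key _ hk

lemma not_dSep_singleton_iff {Z : Set V} {a b : V} (ha : a ∉ Z) :
    ¬ G.DSep {a} {b} Z ↔ G.DConn Z a b := by
  rw [DConn, ← exists_isOpenAfter_iff]
  have key : ∀ w : G.Walk a b, w.IsOpen Z ↔ w.IsOpenAfter Z .bwd := by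
    intro w
    cases w with
    | nil => rfl
    | cons n h p => simp [Walk.IsOpen, Walk.IsOpenAfter, ha]
  simp [DSep, key]

lemma dSep_singleton_iff {Z : Set V} {a b : V} (ha : a ∉ Z) :
    G.DSep {a} {b} Z ↔ ¬ G.DConn Z a b := by
  rw [← not_dSep_singleton_iff ha, not_not]

lemma Adj.symm {u v : V} {n : Nbr} (h : G.Adj u n v) : G.Adj v n.rev u := by
  cases n with
  | fwd => exact h
  | bwd => exact h
  | bi =>
    rw [Adj] at h
    rwa [Nbr.rev, Adj, Sym2.eq_swap]

lemma DConn.symm {Z : Set V} {a b : V} (hb : b ∉ Z) (h : G.DConn Z a b) : G.DConn Z b a := by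
  obtain ⟨k, hk⟩ := h
  -- The reversed walk leaves `t.1` through the reverse of the edge by which the original one
  -- entered it. If the reversed walk reaches `t.1` through an edge of type `m`, the hypothesis
  -- says that this passage is allowed.
  have key : ∀ t : V × Nbr, ReflTransGen (G.Step Z Z) (a, .bwd) t → ∀ m : Nbr,
      (if m.collider t.2.rev then t.1 ∈ Z else t.1 ∉ Z) →
      ∃ j, ReflTransGen (G.Step Z Z) (t.1, m) (a, j) := by
    intro t ht
    induction ht with
    | refl => exact fun m _ => ⟨m, .refl⟩
    | tail _ hst ih =>
      intro m hv
      obtain ⟨j, hj⟩ := ih _ (by rw [Nbr.collider_rev]; exact hst.2)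
      exact ⟨j, hj.head ⟨hst.1.symm, hv⟩⟩
  exact key _ hk .bwd (by simpa using hb)

/-! ### Ancestral detours -/

lemma subset_ancestors (X : Set V) : X ⊆ G.ancestors X := fun x hx => ⟨x, hx, .refl⟩

lemma mem_ancestors_of_dir {X : Set V} {u v : V} (h : G.Dir u v) (hv : v ∈ G.ancestors X) :
    u ∈ G.ancestors X := by
  obtain ⟨x, hx, hr⟩ := hv
  exact ⟨x, hx, hr.head h⟩

lemma mem_ancestors_pair {a b v : V} :
    v ∈ G.ancestors {a, b} ↔ v ∈ G.ancestors {a} ∨ v ∈ G.ancestors {b} := by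
  simp [ancestors]

lemma reach_down {C Z : Set V} {v b : V} (h : ReflTransGen G.Dir v b)
    (hv : v ∉ G.ancestors Z) (n : Nbr) : ∃ k, ReflTransGen (G.Step C Z) (v, n) (b, k) := by
  induction h using ReflTransGen.head_induction_on generalizing n with
  | refl => exact ⟨n, .refl⟩
  | @head u u' huv _ ih =>
    obtain ⟨k, hk⟩ := ih (fun h => hv (mem_ancestors_of_dir huv h)) .fwd
    have hadj : G.Adj u .fwd u' := huv
    exact ⟨k, hk.head (step_of_not_collider hadj (by simp) fun h => hv (subset_ancestors _ h))⟩

lemma reach_up {C Z : Set V} {v a : V} (h : ReflTransGen G.Dir v a)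
    (hv : v ∉ G.ancestors Z) : ReflTransGen (G.Step C Z) (a, .bwd) (v, .bwd) := by
  induction h using ReflTransGen.head_induction_on with
  | refl => exact .refl
  | @head u u' huv _ ih =>
    have hv' := fun h => hv (mem_ancestors_of_dir huv h)
    have hadj : G.Adj u' .bwd u := huv
    exact (ih hv').tail (step_of_not_collider hadj (by simp) fun h => hv' (subset_ancestors _ h))

/-- A walk at an ancestor `v ∉ Z` of `Z` may go down to the first node in `Z` and come back, so that
it returns to `v` through the tail of an edge. -/
lemma reach_detour {Z : Set V} {v : V} (hv : v ∈ G.ancestors Z) (hvZ : v ∉ Z) (n : Nbr) :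
    ReflTransGen (G.Step Z Z) (v, n) (v, .bwd) := by
  obtain ⟨w, hw, h⟩ := hv
  change ReflTransGen G.Dir v w at h
  induction h using ReflTransGen.head_induction_on generalizing n with
  | refl => exact absurd hw hvZ
  | @head u u' huv _ ih =>
    have h₁ : G.Step Z Z (u, n) (u', .fwd) := step_of_not_collider huv (by simp) hvZ
    by_cases hu' : u' ∈ Z
    · exact (ReflTransGen.single h₁).tail (step_of_collider huv rfl hu')
    · exact ((ih hu' .fwd).head h₁).tail (step_of_not_collider huv (by simp) hu')

/-- Colliders need not be in `Z`: if they are ancestors of `Z` or of the start, the walk can be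
rerouted to an open one. At the first collider that is neither, but an ancestor of `E`, a directed
path leads to `E` instead. -/
lemma reach_or_dConn_of_colliders {C Z E : Set V} {a : V}
    (hC : ∀ c ∈ C, c ∈ G.ancestors Z ∨ c ∈ G.ancestors {a} ∨ c ∈ G.ancestors E)
    {t : V × Nbr} (h : ReflTransGen (G.Step C Z) (a, .bwd) t) :
    ReflTransGen (G.Step Z Z) (a, .bwd) t ∨ ∃ e ∈ E, G.DConn Z a e := by
  induction h with
  | refl => exact .inl .refl
  | @tail s t _ hst ih =>
    rcases ih with ih | ih
    swap
    · exact .inr ih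
    obtain ⟨v, n⟩ := s
    obtain ⟨ha, hcond⟩ := hst
    by_cases hc : n.collider t.2 = true
    swap
    · exact .inl (ih.tail ⟨ha, by simpa [hc] using hcond⟩)
    have hvC : v ∈ C := by simpa [hc] using hcond
    by_cases hvZ : v ∈ Z
    · exact .inl (ih.tail (step_of_collider ha hc hvZ))
    have hlast : G.Step Z Z (v, .bwd) t := step_of_not_collider ha (by simp) hvZ
    by_cases hvan : v ∈ G.ancestors Z
    · exact .inl ((ih.trans (reach_detour hvan hvZ n)).tail hlast)
    rcases hC v hvC with h | ⟨a', rfl, h⟩ | ⟨e, he, h⟩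
    · exact absurd h hvan
    · exact .inl ((reach_up h hvan).tail hlast)
    · obtain ⟨k, hk⟩ := reach_down (C := Z) h hvan n
      exact .inr ⟨e, he, k, ih.trans hk⟩

/-- An open walk given a set of ancestors of its end nodes only visits ancestors of its end
nodes. -/
lemma mem_ancestors_of_reach {C D : Set V} {a b : V} (hC : C ⊆ G.ancestors {a, b})
    {s : V × Nbr} {k : Nbr} (h₁ : ReflTransGen (G.Step C D) (a, .bwd) s)
    (h₂ : ReflTransGen (G.Step C D) s (b, k)) : s.1 ∈ G.ancestors {a, b} := by
  -- after entering through an arrowhead, a walk follows directed edges up to a collider or its end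
  have back : ∀ s : V × Nbr, ReflTransGen (G.Step C D) s (b, k) → s.2 ≠ .bwd →
      s.1 ∈ G.ancestors {a, b} := by
    intro s hs
    induction hs using ReflTransGen.head_induction_on with
    | refl => exact fun _ => subset_ancestors _ (by simp)
    | @head s t hst _ ih =>
      intro hs
      by_cases hc : s.2.collider t.2 = true
      · exact hC (by simpa [hc] using hst.2)
      · have ht := Nbr.eq_fwd_of_not_collider (by simpa using hc) hs
        have h : G.Dir s.1 t.1 := by simpa [ht, Adj] using hst.1
        exact mem_ancestors_of_dir h (ih (by simp [ht]))
  induction h₁ with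
  | refl => exact subset_ancestors _ (by simp)
  | @tail u v _ huv ih =>
    by_cases hv : v.2 = .bwd
    · have h : G.Dir v.1 u.1 := by simpa [hv, Adj] using huv.1
      exact mem_ancestors_of_dir h (ih (h₂.head huv))
    · exact back _ h₂ hv

lemma reach_within_ancestors {C D : Set V} {a b : V} (hC : C ⊆ G.ancestors {a, b}) {k : Nbr}
    (h : ReflTransGen (G.Step C D) (a, .bwd) (b, k)) :
    ReflTransGen (fun s t => G.Step C D s t ∧ s.1 ∈ G.ancestors {a, b} ∧
      t.1 ∈ G.ancestors {a, b}) (a, .bwd) (b, k) := by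
  rcases h.all_or_first_not
    (fun s t => s.1 ∈ G.ancestors {a, b} ∧ t.1 ∈ G.ancestors {a, b}) with h | ⟨u, v, h₁, h₂, h₃, h₄⟩
  · exact h
  · have h₁' := h₁.imp fun _ _ h => h.1
    exact absurd ⟨mem_ancestors_of_reach hC h₁' (h₄.head h₂),
      mem_ancestors_of_reach hC (h₁'.tail h₂) h₄⟩ h₃

/-! ### Nearest separators -/

/-- Transitions of walks in `A` without non-collider in `Z`. -/
def ClosureStep (G : ADMG V) (Z A : Set V) (s t : V × Nbr) : Prop :=
  G.Adj s.1 t.2 t.1 ∧ t.1 ∈ A ∧ (s.2.collider t.2 = true ∨ s.1 ∉ Z)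

/-- The nodes reachable from `a` by a walk in `A` without non-collider in `Z`. -/
def closure (G : ADMG V) (a : V) (Z A : Set V) : Set V :=
  {v | ∃ n, ReflTransGen (G.ClosureStep Z A) (a, .bwd) (v, n)}

lemma reach_of_closureStep {Z A C D : Set V} {a : V} (ha : a ∈ A) (hA : A ⊆ C) (hD : D ⊆ Z)
    {t : V × Nbr} (h : ReflTransGen (G.ClosureStep Z A) (a, .bwd) t) :
    t.1 ∈ A ∧ ReflTransGen (G.Step C D) (a, .bwd) t := by
  induction h with
  | refl => exact ⟨ha, .refl⟩
  | tail _ hst ih =>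
    refine ⟨hst.2.1, ih.2.tail ⟨hst.1, ?_⟩⟩
    split_ifs with hc
    · exact hA ih.1
    · exact fun h => (hst.2.2.resolve_left hc) (hD h)

/-- If some separator consists of ancestors of `a` and `b` in `R`, the closure does not reach
`b`. -/
lemma notMem_closure_of_not_dConn {a b : V} {R W : Set V} (hW : W ⊆ R ∩ G.ancestors {a, b})
    (h : ¬ G.DConn W a b) :
    b ∉ G.closure a (R ∩ G.ancestors {a, b}) (G.ancestors {a, b}) := by
  rintro ⟨n, hn⟩
  have h₁ := (reach_of_closureStep (subset_ancestors _ (by simp)) subset_rfl hW hn).2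
  rcases reach_or_dConn_of_colliders (E := {b})
    (fun c hc => .inr (mem_ancestors_pair.1 hc)) h₁ with h₂ | ⟨e, rfl, h₂⟩
  · exact h ⟨n, h₂⟩
  · exact h h₂

lemma isNearestSeparator_closure {a b : V} {R : Set V} (haR : a ∉ R)
    (hb : b ∉ G.closure a (R ∩ G.ancestors {a, b}) (G.ancestors {a, b})) :
    G.IsNearestSeparator a b R ((R ∩ G.ancestors {a, b}) ∩
      G.closure a (R ∩ G.ancestors {a, b}) (G.ancestors {a, b})) where
  subset := Set.inter_subset_left
  dSep := by
    rw [dSep_singleton_iff (fun h => haR h.1.1)]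
    rintro ⟨k, hk⟩
    refine hb ⟨k, ?_⟩
    have h := reach_within_ancestors (fun v hv => hv.1.2) hk
    -- the closure follows an open walk given `R ∩ an ∩ closure`, since a non-collider already in
    -- the closure cannot be in `R ∩ an`
    generalize ((b, k) : V × Nbr) = t at h
    induction h with
    | refl => exact .refl
    | @tail s t _ hst ih =>
      refine ih.tail ⟨hst.1.1, hst.2.2, ?_⟩
      by_cases hc : s.2.collider t.2 = true
      · exact .inl hc
      · have h2 := hst.1.2
        rw [if_neg hc] at h2
        exact .inr fun h => h2 ⟨h, s.2, ih⟩
  nearest := by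
    intro w hw W' hW' hwW
    have haW' : a ∉ W' := fun h => haR (hW' h).1.1
    have hwW' : w ∉ W' := fun h => (hW' h).2 rfl
    rw [not_dSep_singleton_iff hwW'] at hwW
    rw [not_dSep_singleton_iff haW']
    obtain ⟨n, hn⟩ := hw.2
    obtain ⟨hwA, h₁⟩ := reach_of_closureStep (C := G.ancestors {a, b} ∪ W')
      (subset_ancestors _ (by simp)) Set.subset_union_left
      (fun v hv => (hW' hv).1) hn
    obtain ⟨k, hk⟩ := hwW
    have hk' : ReflTransGen (G.Step (G.ancestors {a, b} ∪ W') W') (w, .bwd) (b, k) :=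
      hk.imp fun _ _ h => h.mono Set.subset_union_right subset_rfl
    -- `w` may be passed both as a collider and as a non-collider
    have h₂ : ∃ j, ReflTransGen (G.Step (G.ancestors {a, b} ∪ W') W') (w, n) (b, j) := by
      rcases hk'.cases_head with h | ⟨t, ht, htb⟩
      · exact ⟨n, by rw [(Prod.mk.inj h).1]⟩
      · refine ⟨k, htb.head ⟨ht.1, ?_⟩⟩
        split_ifs
        · exact .inl hwA
        · exact hwW'
    obtain ⟨j, hj⟩ := h₂
    have hC : ∀ c ∈ G.ancestors {a, b} ∪ W',
        c ∈ G.ancestors W' ∨ c ∈ G.ancestors {a} ∨ c ∈ G.ancestors {b} := by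
      rintro c (hc | hc)
      · exact .inr (mem_ancestors_pair.1 hc)
      · exact .inl (subset_ancestors _ hc)
    rcases reach_or_dConn_of_colliders (E := {b}) hC (h₁.trans hj) with h | ⟨e, rfl, h⟩
    · exact ⟨j, h⟩
    · exact h

/-- A nearest separator leaves at least as many nodes connected to `z` as any other separator among
the ancestors: a walk that is open given `W` has no non-collider in `N`, as such a node would be
connected to `z` given `W`, and its colliders are ancestors of `y` or `z`. -/
lemma dConn_of_isNearestSeparator {x y z : V} {R W N : Set V} (hyR : y ∉ R) (hzR : z ∉ R)
    (hN : G.IsNearestSeparator y z R N) (hW : W ⊆ R ∩ G.ancestors {y, z})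
    (hsep : ¬ G.DConn W y z) (hx : G.DConn W x z) (hxN : x ∉ N) :
    G.DConn N x z := by
  have hyW : y ∉ W := fun h => hyR (hW h).1
  have hzW : z ∉ W := fun h => hzR (hW h).1
  have hzN : z ∉ N := fun h => hzR (hN.subset h).1
  have hyN : y ∉ N := fun h => hyR (hN.subset h).1
  obtain ⟨k, hk⟩ := hx.symm hzW
  have hstep : ReflTransGen (G.Step (G.ancestors {y, z}) N) (z, .bwd) (x, k) := by
    generalize ((x, k) : V × Nbr) = t at hk
    induction hk with
    | refl => exact .refl
    | @tail s t hs hst ih =>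
      refine ih.tail ⟨hst.1, ?_⟩
      have h2 := hst.2
      split_ifs at h2 ⊢ with hc
      · exact (hW h2).2
      · intro hsN
        have h := hN.nearest s.1 hsN W (fun v hv => ⟨hW hv, fun h => h2 (h ▸ hv)⟩)
        rw [not_dSep_singleton_iff h2, not_dSep_singleton_iff hyW] at h
        exact hsep (h (DConn.symm h2 ⟨s.2, hs⟩))
  rcases reach_or_dConn_of_colliders (E := {y})
    (fun c hc => .inr (mem_ancestors_pair.1 hc).symm) hstep with h | ⟨e, rfl, h⟩
  · exact DConn.symm hxN ⟨k, h⟩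
  · exact absurd (h.symm hyN) ((dSep_singleton_iff hyN).1 hN.dSep)

/-! ### Ancestral instruments -/

lemma not_dConn_inter_ancestors {y z : V} {W : Set V} (h : ¬ G.DConn W y z) :
    ¬ G.DConn (W ∩ G.ancestors {y, z}) y z := by
  rintro ⟨k, hk⟩
  refine h ⟨k, (reach_within_ancestors Set.inter_subset_right hk).imp ?_⟩
  intro s t hst
  refine ⟨hst.1.1, ?_⟩
  have h2 := hst.1.2
  split_ifs at h2 ⊢
  · exact h2.1
  · exact fun h => h2 ⟨h, hst.2.1⟩

/-- If `c ∉ an y` is connected to `y` given the other ancestors of `y` and `c` in `W`, then a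
walk that is open given `W` connects them and enters `c` through an arrowhead. -/
lemma exists_reach_arrowhead {y c : V} {W : Set V} (hcy : c ∉ G.ancestors {y})
    (h : G.DConn ((W ∩ G.ancestors {y, c}) \ {c}) y c) :
    ∃ k, k ≠ .bwd ∧ ReflTransGen (G.Step W W) (y, .bwd) (c, k) := by
  obtain ⟨k, hk⟩ := h
  have h := reach_within_ancestors (fun v hv => hv.1.2) hk
  have hne : y ≠ c := by
    rintro rfl
    exact hcy (subset_ancestors _ rfl)
  -- if `c` were left through a tail, the previous node would be an ancestor of `y` (then so is
  -- `c`) or of `c` (then there is a cycle)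
  have arrow : ∀ t, ReflTransGen (fun s t => G.Step ((W ∩ G.ancestors {y, c}) \ {c})
      ((W ∩ G.ancestors {y, c}) \ {c}) s t ∧ s.1 ∈ G.ancestors {y, c} ∧
      t.1 ∈ G.ancestors {y, c}) (y, .bwd) t → t.1 = c → t.2 ≠ .bwd := by
    intro t ht htc htb
    rcases ht.cases_tail with h | ⟨s, _, hst⟩
    · subst h
      exact hne htc
    · have hdir : G.Dir c s.1 := by simpa [htb, htc, Adj] using hst.1.1
      rcases mem_ancestors_pair.1 hst.2.1 with hs | ⟨_, rfl, hs⟩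
      · exact hcy (mem_ancestors_of_dir hdir hs)
      · exact G.acyclic _ (TransGen.head' hdir hs)
  have good : ∀ s t : V × Nbr, (G.Step ((W ∩ G.ancestors {y, c}) \ {c})
      ((W ∩ G.ancestors {y, c}) \ {c}) s t ∧ s.1 ∈ G.ancestors {y, c} ∧
      t.1 ∈ G.ancestors {y, c}) ∧ s.1 ≠ c → G.Step W W s t := by
    rintro s t ⟨hst, hs⟩
    refine ⟨hst.1.1, ?_⟩
    have h2 := hst.1.2
    split_ifs at h2 ⊢
    · exact h2.1.1
    · exact fun h => h2 ⟨⟨h, hst.2.1⟩, hs⟩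
  rcases h.all_or_first_not (fun s _ => s.1 ≠ c) with h' | ⟨u, v, h₁, h₂, h₃, h₄⟩
  · exact ⟨k, arrow _ h rfl, h'.imp good⟩
  · obtain ⟨u, m⟩ := u
    obtain rfl : u = c := not_not.1 h₃
    exact ⟨m, arrow _ (h₁.imp fun _ _ h => h.1) rfl, h₁.imp good⟩

/-- An instrument can be replaced by one whose conditioning set consists of ancestors: along an open
walk from `x` to `z`, the first collider that is not an ancestor of `y` serves as the new
instrument, or `z` itself if there is none. -/
lemma exists_ancestral_instrument {x y z : V} {W : Set V} (hzW : z ∉ W)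
    (hconn : G.DConn W x z) (hsep : ¬ G.DConn W y z) :
    ∃ z' W', (z' = z ∨ z' ∈ W) ∧ W' ⊆ W ∩ G.ancestors {y, z'} ∧ z' ∉ W' ∧
      G.DConn W' x z' ∧ ¬ G.DConn W' y z' := by
  obtain ⟨k, hk⟩ := hconn
  rcases hk.all_or_first_not (fun s t => s.2.collider t.2 = true → s.1 ∈ G.ancestors {y})
    with h | ⟨u, v, h₁, h₂, h₃, h₄⟩
  · refine ⟨z, W ∩ G.ancestors {y, z}, .inl rfl, subset_rfl, fun h => hzW h.1, ⟨k, h.imp ?_⟩,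
      not_dConn_inter_ancestors hsep⟩
    rintro s t ⟨hst, hc⟩
    refine ⟨hst.1, ?_⟩
    have h2 := hst.2
    split_ifs at h2 ⊢ with hcol
    · exact ⟨h2, mem_ancestors_pair.2 (.inl (hc hcol))⟩
    · exact fun h => h2 h.1
  · obtain ⟨c, m⟩ := u
    push Not at h₃
    obtain ⟨hcol, hcy⟩ := h₃
    have hcW : c ∈ W := by simpa [hcol] using h₂.2
    refine ⟨c, (W ∩ G.ancestors {y, c}) \ {c}, .inr hcW, Set.sdiff_subset, fun h => h.2 rfl,
      ⟨m, h₁.imp ?_⟩, ?_⟩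
    · rintro s t ⟨hst, hc⟩
      refine ⟨hst.1, ?_⟩
      have h2 := hst.2
      split_ifs at h2 ⊢ with hcol
      · refine ⟨⟨h2, mem_ancestors_pair.2 (.inl (hc hcol))⟩, fun h => hcy ?_⟩
        rw [← Set.mem_singleton_iff.1 h]
        exact hc hcol
      · exact fun h => h2 h.1.1
    · intro hcon
      obtain ⟨j, hj, hyc⟩ := exists_reach_arrowhead hcy hcon
      exact hsep ⟨k, (hyc.tail (step_of_collider h₂.1
        (Nbr.collider_of_ne_bwd hcol hj) hcW)).trans h₄⟩

/-! ### Cutting the causal edges -/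

lemma mem_descendants_of_dir {X : Set V} {u v : V} (hu : u ∈ G.descendants X) (h : G.Dir u v) :
    v ∈ G.descendants X := by
  obtain ⟨c, hc, hcu⟩ := hu
  exact ⟨c, hc, hcu.tail h⟩

lemma cutCausal_adj_iff {x y u v : V} {n : Nbr} : (G.cutCausal x y).Adj u n v ↔
    G.Adj u n v ∧ ¬ (n = .fwd ∧ u = x ∧ v ∈ G.causal x y) ∧
      ¬ (n = .bwd ∧ v = x ∧ u ∈ G.causal x y) := by
  classical
  cases n <;> simp [cutCausal, Adj]

/-- An open walk from `x` into a causal node is bound to follow directed edges among the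
descendants of causal nodes for ever, and a causal edge traversed backwards returns to the start. So
open walks from `x` to a non-forbidden node may be taken without causal edges. -/
lemma dConn_cutCausal_iff {x y z : V} {W : Set V} (hW : Disjoint W (G.forb x y))
    (hz : z ∉ G.forb x y) : (G.cutCausal x y).DConn W x z ↔ G.DConn W x z := by
  constructor
  · rintro ⟨k, hk⟩
    exact ⟨k, hk.imp fun s t h => ⟨(cutCausal_adj_iff.1 h.1).1, h.2⟩⟩
  rintro ⟨k, hk⟩
  have trapped : ∀ s t : V × Nbr, ReflTransGen (G.Step W W) s t → s.2 = .fwd →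
      s.1 ∈ G.descendants (G.causal x y) →
      t.2 = .fwd ∧ t.1 ∈ G.descendants (G.causal x y) := by
    intro s t h hs hs'
    induction h with
    | refl => exact ⟨hs, hs'⟩
    | @tail u v _ huv ih =>
      have hu : u.1 ∉ W := fun h => hW.le_bot ⟨h, .inl ih.2⟩
      have hc : u.2.collider v.2 = false := by
        by_contra hc
        have h2 := huv.2
        rw [if_pos (by simpa using hc)] at h2
        exact hu h2
      have hv := Nbr.eq_fwd_of_not_collider hc (by simp [ih.1])
      have hdir : G.Dir u.1 v.1 := by simpa [hv, Adj] using huv.1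
      exact ⟨hv, mem_descendants_of_dir ih.2 hdir⟩
  have key : ∀ t : V × Nbr, ReflTransGen (G.Step W W) (x, .bwd) t →
      ReflTransGen (G.Step W W) t (z, k) →
      ReflTransGen ((G.cutCausal x y).Step W W) (x, .bwd) t := by
    intro t ht
    induction ht with
    | refl => exact fun _ => .refl
    | @tail s t _ hst ih =>
      intro htz
      by_cases hb : t.2 = .bwd ∧ t.1 = x ∧ s.1 ∈ G.causal x y
      · obtain ⟨v, n⟩ := t
        obtain ⟨rfl, rfl, _⟩ := hb
        exact .refl
      by_cases hf : t.2 = .fwd ∧ s.1 = x ∧ t.1 ∈ G.causal x y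
      · exact absurd (.inl (trapped _ _ htz hf.1 ⟨_, hf.2.2, .refl⟩).2) hz
      · exact (ih (htz.head hst)).tail ⟨cutCausal_adj_iff.2 ⟨hst.1, hf, hb⟩, hst.2⟩
  exact ⟨k, key _ hk .refl⟩

lemma isValidCIS_singleton_iff {x y z : V} {W : Set V} (hxy : x ≠ y) :
    G.IsValidCIS x y {z} W ↔ z ∉ G.forb x y ∧ z ≠ y ∧ z ∉ W ∧ y ∉ W ∧
      Disjoint W (G.forb x y) ∧ G.DConn W x z ∧ ¬ (G.cutCausal x y).DConn W y z := by
  have hx : x ∈ G.forb x y := .inr rfl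
  constructor
  · intro h
    have hW := h.disjoint_W
    have hZ := h.disjoint_Z
    have hZW := h.disjoint_ZW
    have hF := h.forb_disjoint
    simp only [Set.disjoint_insert_left, Set.disjoint_singleton_left, Set.disjoint_union_left,
      Set.mem_singleton_iff] at hW hZ hZW hF
    exact ⟨hF.1, fun h => hZ.2 h.symm, hZW, hW.2, hF.2, (not_dSep_singleton_iff hW.1).1 h.not_dSep,
      (dSep_singleton_iff hW.2).1 h.dSep_cut⟩
  · rintro ⟨hzF, hzy, hzW, hyW, hWF, hc, hs⟩
    have hxW : x ∉ W := fun h => hWF.le_bot ⟨h, hx⟩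
    refine ⟨hxy, ?_, ?_, ?_, ?_, (not_dSep_singleton_iff hxW).2 hc, (dSep_singleton_iff hyW).2 hs⟩
    · simp only [Set.disjoint_insert_left, Set.disjoint_singleton_left, Set.mem_singleton_iff]
      exact ⟨fun h => hzF (h ▸ hx), hzy.symm⟩
    · simp [hxW, hyW]
    · simpa using hzW
    · simp [hzF, hWF]

/-- If there is an instrument at all, then for some node `z` the candidate tried by the algorithm
exists and connects to `x`. -/
lemma IsValidCIS.exists_closure {x y z : V} {W : Set V} (h : G.IsValidCIS x y {z} W) :
    ∃ z', z' ∉ G.forb x y ∧ z' ≠ y ∧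
      ∃ A Z₀, A = (G.cutCausal x y).ancestors {y, z'} ∧ Z₀ = (G.forb x y ∪ {y, z'})ᶜ ∩ A ∧
        z' ∉ (G.cutCausal x y).closure y Z₀ A ∧
        G.DConn (Z₀ ∩ (G.cutCausal x y).closure y Z₀ A) x z' := by
  obtain ⟨hzF, hzy, hzW, hyW, hWF, hc, hs⟩ := (isValidCIS_singleton_iff h.ne).1 h
  obtain ⟨z', W', hz', hW', hzW', hxz, hyz⟩ :=
    exists_ancestral_instrument hzW ((dConn_cutCausal_iff hWF hzF).2 hc) hs
  have hx : x ∈ G.forb x y := .inr rfl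
  have hz'F : z' ∉ G.forb x y := by
    rcases hz' with rfl | hz'
    · exact hzF
    · exact fun h => hWF.le_bot ⟨hz', h⟩
  have hz'y : z' ≠ y := by
    rcases hz' with rfl | hz'
    · exact hzy
    · rintro rfl
      exact hyW hz'
  have hW'R : W' ⊆ (G.forb x y ∪ {y, z'})ᶜ ∩ (G.cutCausal x y).ancestors {y, z'} := by
    intro v hv
    refine ⟨?_, (hW' hv).2⟩
    rintro (hF | rfl | rfl)
    · exact hWF.le_bot ⟨(hW' hv).1, hF⟩
    · exact hyW (hW' hv).1
    · exact hzW' hv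
  have hyR : y ∉ (G.forb x y ∪ {y, z'})ᶜ := by simp
  have hclo := notMem_closure_of_not_dConn hW'R hyz
  refine ⟨z', hz'F, hz'y, _, _, rfl, rfl, hclo, ?_⟩
  refine (dConn_cutCausal_iff (Set.disjoint_left.2 fun v hv hF => hv.1.1 (.inl hF)) hz'F).1 ?_
  exact dConn_of_isNearestSeparator hyR (by simp) (isNearestSeparator_closure hyR hclo) hW'R
    hyz hxz (fun h => h.1.1 (.inl hx))

end

end ADMG

/-! ### Results and costs of step-counted programs -/

namespace Timed

section

variable {α β ι σ : Type}

@[simp] lemma val_bind (t : Timed α) (f : α → Timed β) : (t >>= f).val = (f t.val).val := rfl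

@[simp] lemma steps_bind (t : Timed α) (f : α → Timed β) :
    (t >>= f).steps = t.steps + (f t.val).steps := rfl

@[simp] lemma val_pure (a : α) : (pure a : Timed α).val = a := rfl

@[simp] lemma steps_pure (a : α) : (pure a : Timed α).steps = 0 := rfl

@[simp] lemma val_step (a : α) : (step a).val = a := rfl

@[simp] lemma steps_step (a : α) : (step a).steps = 1 := rfl

@[simp] lemma val_read (a : ι → β) (i : ι) : (read a i).val = a i := rfl

@[simp] lemma steps_read (a : ι → β) (i : ι) : (read a i).steps = 1 := rfl

@[simp] lemma val_write [DecidableEq ι] (a : ι → β) (i : ι) (b : β) :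
    (write a i b).val = Function.update a i b := rfl

@[simp] lemma steps_write [DecidableEq ι] (a : ι → β) (i : ι) (b : β) :
    (write a i b).steps = 1 := rfl

@[simp] lemma val_newArray (k : ℕ) (b : β) : (newArray k b : Timed (ι → β)).val = fun _ => b := rfl

@[simp] lemma steps_newArray (k : ℕ) (b : β) : (newArray k b : Timed (ι → β)).steps = k := rfl

@[simp] lemma val_isEq [DecidableEq α] (a b : α) : (isEq a b).val = decide (a = b) := rfl

@[simp] lemma steps_isEq [DecidableEq α] (a b : α) : (isEq a b).steps = 1 := rfl

@[simp] lemma forEach_nil (s : σ) (f : σ → α → Timed σ) : forEach [] s f = step s := rfl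

lemma forEach_cons (a : α) (l : List α) (s : σ) (f : σ → α → Timed σ) :
    forEach (a :: l) s f = (do
      let a ← step a
      let s ← f s a
      forEach l s f) := rfl

lemma steps_forEach_le {f : σ → α → Timed σ} {c : ℕ} (h : ∀ s a, (f s a).steps ≤ c)
    (l : List α) (s : σ) : (forEach l s f).steps ≤ l.length * (c + 1) + 1 := by
  induction l generalizing s with
  | nil => simp
  | cons a l ih =>
    simp only [forEach_cons, steps_bind, steps_step, val_step, List.length_cons]
    have := ih (f s a).val
    have := h s a
    linarith

lemma steps_forEach_le_sum {f : σ → α → Timed σ} {c : α → ℕ} (h : ∀ s a, (f s a).steps ≤ c a)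
    (l : List α) (s : σ) : (forEach l s f).steps ≤ (l.map c).sum + l.length + 1 := by
  induction l generalizing s with
  | nil => simp
  | cons a l ih =>
    simp only [forEach_cons, steps_bind, steps_step, val_step, List.length_cons, List.map_cons,
      List.sum_cons]
    have := ih (f s a).val
    have := h s a
    omega

lemma val_forEach_write [DecidableEq ι] {f : (ι → β) → ι → Timed (ι → β)} {h : ι → β}
    (hf : ∀ a i, (f a i).val = Function.update a i (h i)) (l : List ι) (a : ι → β) (i : ι) :
    (forEach l a f).val i = if i ∈ l then h i else a i := by
  induction l generalizing a with
  | nil => simp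
  | cons j l ih =>
    simp only [forEach_cons, val_bind, val_step, ih, hf, List.mem_cons, Function.update_apply]
    grind

end

end Timed

/-! ### Correctness and cost of the search -/

lemma Nbr.mem_list (n : Nbr) : n ∈ [Nbr.fwd, Nbr.bwd, Nbr.bi] := by cases n <;> simp

instance : Fintype Nbr := ⟨{.fwd, .bwd, .bi}, fun n => by cases n <;> simp⟩

lemma Nbr.sum_univ {M : Type*} [AddCommMonoid M] (f : Nbr → M) :
    ∑ n, f n = f .fwd + (f .bwd + f .bi) := by
  change Finset.sum {Nbr.fwd, Nbr.bwd, Nbr.bi} f = _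
  rw [Finset.sum_insert (by simp), Finset.sum_insert (by simp), Finset.sum_singleton]

lemma Nbr.card_univ : Fintype.card Nbr = 3 := rfl

/-- The total number of entries of the neighbour lists of `v`; a directed or bidirected edge counts
once at each of its ends. -/
def AdjLists.degree {V : Type} (g : AdjLists V) (v : V) : ℕ := ∑ n, (g.nbrs n v).length

/-- The size of the input: the number of nodes plus the lengths of all neighbour lists. -/
def AdjLists.size {V : Type} [Fintype V] (g : AdjLists V) : ℕ :=
  Fintype.card V + ∑ v, g.degree v

namespace Algo

open Timed Relation

section

variable {V : Type}

/-- The transitions of the state-space graph explored with the test `φ`. -/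
def Trans (g : AdjLists V) (φ : V × Nbr → V × Nbr → Timed Bool) (s t : V × Nbr) : Prop :=
  t.1 ∈ g.nbrs t.2 s.1 ∧ (φ s t).val = true

/-- Total weight of the states that are not yet marked or on the stack. For constant weight `1` it
bounds the number of remaining rounds, for the weight of a state being the cost of its expansion it
bounds the remaining number of steps. -/
def potential [Fintype V] (f : V × Nbr → ℕ) (st : Search V) : ℕ :=
  (∑ t, if st.visited t = true then 0 else f t) + (st.stack.map f).sum

/-- The search `st'` arises from `st` by visiting exactly the states in `P`: those not yet marked are
marked and put on the stack, each once, so that no potential changes. -/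
structure Adds [Fintype V] (P : V × Nbr → Prop) (st st' : Search V) : Prop where
  visited : ∀ t, st'.visited t = true ↔ st.visited t = true ∨ P t
  stack : ∀ t, t ∈ st'.stack ↔ t ∈ st.stack ∨ (P t ∧ ¬ st.visited t = true)
  potential : ∀ f, potential f st' = potential f st

lemma Adds.of_empty [Fintype V] {P : V × Nbr → Prop} (h : ∀ t, ¬ P t) (st : Search V) :
    Adds P st st :=
  ⟨by simp [h], by simp [h], fun _ => rfl⟩

lemma Adds.congr [Fintype V] {P Q : V × Nbr → Prop} {st st' : Search V} (h : Adds P st st')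
    (hPQ : ∀ t, P t ↔ Q t) : Adds Q st st' := by
  obtain rfl : P = Q := funext fun t => propext (hPQ t)
  exact h

lemma Adds.trans [Fintype V] {P Q : V × Nbr → Prop} {s₁ s₂ s₃ : Search V} (h : Adds P s₁ s₂)
    (h' : Adds Q s₂ s₃) : Adds (fun t => P t ∨ Q t) s₁ s₃ where
  visited t := by rw [h'.visited, h.visited, or_assoc]
  stack t := by
    rw [h'.stack, h.stack, h.visited]
    tauto
  potential f := by rw [h'.potential, h.potential]

lemma adds_visit [Fintype V] [DecidableEq V] (st : Search V) (t : V × Nbr) :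
    Adds (· = t) st (visit st t).val := by
  by_cases h : st.visited t = true
  · have hv : (visit st t).val = st := by simp [visit, h]
    rw [hv]
    exact ⟨fun u => by grind, fun u => by grind, fun _ => rfl⟩
  · have hv : (visit st t).val = ⟨Function.update st.visited t true, t :: st.stack⟩ := by
      simp [visit, h]
    rw [hv]
    refine ⟨fun u => ?_, fun u => ?_, fun f => ?_⟩
    · simp only [Function.update_apply]
      grind
    · simp only [List.mem_cons]
      grind
    · simp only [potential, List.map_cons, List.sum_cons]
      rw [← Finset.add_sum_erase _ _ (Finset.mem_univ t),
        ← Finset.add_sum_erase (a := t) Finset.univ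
          (fun u => if st.visited u = true then 0 else f u) (Finset.mem_univ t)]
      have : ∀ u ∈ Finset.univ.erase t, (if Function.update st.visited t true u = true then 0
          else f u) = if st.visited u = true then 0 else f u := by
        intro u hu
        rw [Function.update_of_ne (Finset.ne_of_mem_erase hu)]
      rw [Finset.sum_congr rfl this]
      simp [h]
      ring

lemma steps_visit_le [DecidableEq V] (st : Search V) (t : V × Nbr) : (visit st t).steps ≤ 3 := by
  by_cases h : st.visited t = true <;> simp [visit, h]

lemma adds_forEach [Fintype V] {α : Type} {f : Search V → α → Timed (Search V)}
    {P : α → V × Nbr → Prop}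
    (h : ∀ st a, Adds (P a) st (f st a).val) (l : List α) (st : Search V) :
    Adds (fun t => ∃ a ∈ l, P a t) st (forEach l st f).val := by
  induction l generalizing st with
  | nil => exact Adds.of_empty (by simp) st
  | cons a l ih =>
    simp only [forEach_cons, val_bind, val_step]
    exact ((h st a).trans (ih _)).congr (by simp)

lemma adds_expand [Fintype V] [DecidableEq V] (g : AdjLists V)
    (φ : V × Nbr → V × Nbr → Timed Bool) (st : Search V) (s : V × Nbr) :
    Adds (Trans g φ s) st (expand g φ st s).val := by
  have h₁ : ∀ n (st : Search V) (v : V), Adds (fun t => t = (v, n) ∧ (φ s t).val = true) st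
      (do if ← φ s (v, n) then visit st (v, n) else return st : Timed (Search V)).val := by
    intro n st v
    by_cases h : (φ s (v, n)).val = true
    · simp only [val_bind, h, if_true]
      exact (adds_visit st (v, n)).congr fun t => by grind
    · simp only [val_bind, h]
      exact Adds.of_empty (by grind) st
  refine (adds_forEach (P := fun n t => ∃ v ∈ g.nbrs n s.1, t = (v, n) ∧ (φ s t).val = true)
    (fun st n => ?_) _ _).congr fun t => ?_
  · simp only [val_bind, val_read]
    exact adds_forEach (h₁ n) _ _
  · obtain ⟨v, n⟩ := t
    simp only [Trans]
    constructor
    · rintro ⟨n', _, v', hv', he, hφ⟩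
      cases he
      exact ⟨hv', hφ⟩
    · rintro ⟨h, hφ⟩
      exact ⟨n, n.mem_list, v, h, rfl, hφ⟩

lemma steps_expand_le [DecidableEq V] (g : AdjLists V) {φ : V × Nbr → V × Nbr → Timed Bool} {c : ℕ}
    (hφ : ∀ s t, (φ s t).steps ≤ c) (st : Search V) (s : V × Nbr) :
    (expand g φ st s).steps ≤ (c + 4) * g.degree s.1 + 10 := by
  have h := steps_forEach_le_sum (f := fun (st : Search V) n => do
    let l ← read (g.nbrs n) s.1
    forEach l st fun st v => do
      if ← φ s (v, n) then visit st (v, n) else return st)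
    (c := fun n => (g.nbrs n s.1).length * (c + 4) + 2) (fun st n => ?_)
    [Nbr.fwd, Nbr.bwd, Nbr.bi] st
  · refine h.trans ?_
    simp only [AdjLists.degree, Nbr.sum_univ, List.map_cons, List.map_nil, List.sum_cons,
      List.sum_nil, List.length_cons, List.length_nil]
    linarith
  · simp only [steps_bind, steps_read, val_read]
    have h := steps_forEach_le (f := fun (st : Search V) v => do
      if ← φ s (v, n) then visit st (v, n) else return st) (c := c + 3) (fun st v => ?_)
      (g.nbrs n s.1) st
    · linarith
    · have h₁ := hφ s (v, n)
      have h₂ := steps_visit_le st (v, n)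
      simp only [steps_bind]
      split_ifs
      · omega
      · simp only [steps_pure]
        omega

lemma searchLoop_nil [DecidableEq V] (g : AdjLists V) (φ : V × Nbr → V × Nbr → Timed Bool) (k : ℕ)
    (vis : V × Nbr → Bool) :
    (searchLoop g φ k ⟨vis, []⟩).val = ⟨vis, []⟩ ∧ (searchLoop g φ k ⟨vis, []⟩).steps = 1 := by
  cases k <;> exact ⟨rfl, rfl⟩

lemma searchLoop_cons [DecidableEq V] (g : AdjLists V) (φ : V × Nbr → V × Nbr → Timed Bool) (k : ℕ)
    (vis : V × Nbr → Bool) (s : V × Nbr) (rest : List (V × Nbr)) :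
    (searchLoop g φ (k + 1) ⟨vis, s :: rest⟩).val =
        (searchLoop g φ k (expand g φ ⟨vis, rest⟩ s).val).val ∧
      (searchLoop g φ (k + 1) ⟨vis, s :: rest⟩).steps = 1 + ((expand g φ ⟨vis, rest⟩ s).steps +
        (searchLoop g φ k (expand g φ ⟨vis, rest⟩ s).val).steps) :=
  ⟨rfl, rfl⟩

lemma iff_exists_reach_of_closed {α : Type} {r : α → α → Prop} {q : α → Prop}
    (h : ∀ s t, q s → r s t → q t) (t : α) : q t ↔ ∃ s, q s ∧ ReflTransGen r s t := by
  refine ⟨fun ht => ⟨t, ht, .refl⟩, ?_⟩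
  rintro ⟨s, hs, hst⟩
  induction hst with
  | refl => exact hs
  | tail _ huv ih => exact h _ _ ih huv

/-- The hypotheses form the loop invariant: marked states on the stack wait for expansion, and all
others have only marked successors. When the stack is empty, the marked states are closed under
transitions. -/
lemma visited_searchLoop [Fintype V] [DecidableEq V] (g : AdjLists V)
    (φ : V × Nbr → V × Nbr → Timed Bool) (k : ℕ)
    (st : Search V) (hk : potential (fun _ => 1) st ≤ k)
    (h₁ : ∀ t ∈ st.stack, st.visited t = true)
    (h₂ : ∀ s t, st.visited s = true → s ∉ st.stack → Trans g φ s t → st.visited t = true)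
    (t : V × Nbr) :
    (searchLoop g φ k st).val.visited t = true ↔
      ∃ s, st.visited s = true ∧ ReflTransGen (Trans g φ) s t := by
  induction k generalizing st with
  | zero =>
    obtain ⟨vis, stack⟩ := st
    have hnil : stack = [] := by
      rw [← List.length_eq_zero_iff]
      simp only [potential, List.map_const', List.sum_replicate] at hk
      simp only [smul_eq_mul, mul_one] at hk
      omega
    subst hnil
    rw [(searchLoop_nil g φ 0 vis).1]
    exact iff_exists_reach_of_closed (q := fun s => vis s = true)
        (fun s t hs => h₂ s t hs (by simp)) t
  | succ k ih =>
    obtain ⟨vis, stack⟩ := st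
    cases stack with
    | nil =>
      rw [(searchLoop_nil g φ (k + 1) vis).1]
      exact iff_exists_reach_of_closed (q := fun s => vis s = true)
        (fun s t hs => h₂ s t hs (by simp)) t
    | cons s rest =>
      rw [(searchLoop_cons g φ k vis s rest).1]
      have hadd := adds_expand g φ ⟨vis, rest⟩ s
      generalize (expand g φ ⟨vis, rest⟩ s).val = st' at hadd
      have hs : vis s = true := h₁ s (by simp)
      rw [ih st']
      · constructor
        · rintro ⟨u, hu, hut⟩
          rcases (hadd.visited u).1 hu with hu | hu
          · exact ⟨u, hu, hut⟩
          · exact ⟨s, hs, hut.head hu⟩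
        · rintro ⟨u, hu, hut⟩
          exact ⟨u, (hadd.visited u).2 (.inl hu), hut⟩
      · rw [hadd.potential]
        simp only [potential, List.map_cons, List.sum_cons] at hk ⊢
        omega
      · intro u hu
        rw [hadd.visited]
        rcases (hadd.stack u).1 hu with hu | hu
        · exact .inl (h₁ u (List.mem_cons_of_mem _ hu))
        · exact .inr hu.1
      · intro u v hu hus huv
        rw [hadd.visited]
        rw [hadd.visited] at hu
        rw [hadd.stack] at hus
        push Not at hus
        by_cases hsu : u = s
        · exact .inr (hsu ▸ huv)
        · have hu' : vis u = true := by
            rcases hu with hu | hu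
            · exact hu
            · exact hus.2 hu
          exact .inl (h₂ u v hu' (by simp [hsu, hus.1]) huv)

/-- Each round takes the expanded state off the stack and thereby pays for its expansion out of the
potential. -/
lemma steps_searchLoop_le [Fintype V] [DecidableEq V] (g : AdjLists V)
    {φ : V × Nbr → V × Nbr → Timed Bool} {c : ℕ} (hφ : ∀ s t, (φ s t).steps ≤ c) (k : ℕ)
    (st : Search V) :
    (searchLoop g φ k st).steps ≤
      potential (fun s => (c + 4) * g.degree s.1 + 11) st + 1 := by
  induction k generalizing st with
  | zero =>
    change 1 ≤ _
    omega
  | succ k ih =>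
    obtain ⟨vis, stack⟩ := st
    cases stack with
    | nil =>
      rw [(searchLoop_nil g φ (k + 1) vis).2]
      omega
    | cons s rest =>
      rw [(searchLoop_cons g φ k vis s rest).2]
      have h := ih (expand g φ ⟨vis, rest⟩ s).val
      rw [(adds_expand g φ ⟨vis, rest⟩ s).potential] at h
      have h' := steps_expand_le g hφ ⟨vis, rest⟩ s
      simp only [potential, List.map_cons, List.sum_cons] at h ⊢
      omega

lemma val_tabulate [DecidableEq V] {g : AdjLists V} (hg : ∀ v, v ∈ g.nodes)
    (f : V → Timed Bool) (v : V) :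
    (tabulate g f).val v = (f v).val := by
  simp only [tabulate, val_bind, val_newArray]
  rw [val_forEach_write (h := fun v => (f v).val) (fun a v => rfl), if_pos (hg v)]

lemma steps_tabulate_le [DecidableEq V] {g : AdjLists V} {f : V → Timed Bool} {c : ℕ}
    (hf : ∀ v, (f v).steps ≤ c) : (tabulate g f).steps ≤ g.nodes.length * (c + 3) + 1 := by
  simp only [tabulate, steps_bind, steps_newArray]
  have h := steps_forEach_le (f := fun (a : V → Bool) v => do
    let b ← f v
    write a v b) (c := c + 1) (fun a v => by simpa using hf v) g.nodes
    (newArray g.nodes.length false : Timed (V → Bool)).val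
  linarith

lemma potential_empty [Fintype V] (f : V × Nbr → ℕ) :
    potential f ⟨fun _ => false, []⟩ = ∑ t, f t := by
  simp [potential]

lemma val_reach [Fintype V] [DecidableEq V] {g : AdjLists V} (hg : ∀ v, v ∈ g.nodes)
    (hlen : g.nodes.length = Fintype.card V)
    (X : List V) (n₀ : Nbr) (φ : V × Nbr → V × Nbr → Timed Bool) (v : V) :
    (reach g X n₀ φ).val v = true ↔
      ∃ u ∈ X, ∃ n, ReflTransGen (Trans g φ) (u, n₀) (v, n) := by
  have hadd := adds_forEach (f := fun st v => visit st (v, n₀))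
    (fun st v => adds_visit st (v, n₀)) X ⟨fun _ => false, []⟩
  have key : ∀ t, _ ↔ _ := visited_searchLoop g φ (3 * g.nodes.length)
    (forEach X ⟨fun _ => false, []⟩ fun st v => visit st (v, n₀)).val ?_ ?_ ?_
  · simp only [reach, val_bind, val_tabulate hg, val_newArray, val_read, val_step,
      Bool.or_eq_true, key, hadd.visited]
    constructor
    · rintro ((⟨s, hs, h⟩ | ⟨s, hs, h⟩) | ⟨s, hs, h⟩) <;>
      · obtain ⟨u, hu, rfl⟩ := hs.resolve_left (by simp)
        exact ⟨u, hu, _, h⟩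
    · rintro ⟨u, hu, n, h⟩
      have hex : ∃ s : V × Nbr, (false = true ∨ ∃ a ∈ X, s = (a, n₀)) ∧
        ReflTransGen (Trans g φ) s (v, n) := ⟨_, .inr ⟨u, hu, rfl⟩, h⟩
      cases n
      · exact .inl (.inl hex)
      · exact .inl (.inr hex)
      · exact .inr hex
  · rw [hadd.potential, potential_empty]
    simp [Nbr.card_univ, hlen, mul_comm]
  · intro t ht
    rw [hadd.visited]
    exact .inr (((hadd.stack t).1 ht).resolve_left (by simp)).1
  · intro s t hs hs'
    have h : ∃ a ∈ X, s = (a, n₀) := ((hadd.visited s).1 hs).resolve_left (by simp)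
    exact absurd ((hadd.stack s).2 (.inr ⟨h, by simp⟩)) hs'

/-- The initial potential is the total cost of expanding all `3 p` states, which is linear in the
size of the input. -/
lemma steps_reach_le [Fintype V] [DecidableEq V] {g : AdjLists V}
    (hlen : g.nodes.length = Fintype.card V)
    (X : List V) (n₀ : Nbr) {φ : V × Nbr → V × Nbr → Timed Bool} {c : ℕ}
    (hφ : ∀ s t, (φ s t).steps ≤ c) :
    (reach g X n₀ φ).steps ≤ (3 * c + 43) * g.size + 4 * X.length + 3 := by
  have hadd := adds_forEach (f := fun st v => visit st (v, n₀))
    (fun st v => adds_visit st (v, n₀)) X ⟨fun _ => false, []⟩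
  have h₁ := steps_forEach_le (f := fun st v => visit st (v, n₀))
    (fun st v => steps_visit_le st (v, n₀)) X ⟨fun _ => false, []⟩
  have h₂ := steps_searchLoop_le g hφ (3 * g.nodes.length)
    (forEach X ⟨fun _ => false, []⟩ fun st v => visit st (v, n₀)).val
  rw [hadd.potential, potential_empty, Fintype.sum_prod_type] at h₂
  simp only [Finset.sum_add_distrib, ← Finset.mul_sum, Finset.sum_const,
    Finset.card_univ, smul_eq_mul, Nbr.card_univ] at h₂
  have h₃ : ∀ st : Search V, (tabulate g fun v => do
      let a ← read st.visited (v, .fwd)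
      let b ← read st.visited (v, .bwd)
      let c ← read st.visited (v, .bi)
      step (a || b || c)).steps ≤ g.nodes.length * (4 + 3) + 1 :=
    fun st => steps_tabulate_le fun v => by simp
  have h₄ := h₃ (searchLoop g φ (3 * g.nodes.length)
    (forEach X ⟨fun _ => false, []⟩ fun st v => visit st (v, n₀)).val).val
  simp only [reach, steps_bind, steps_newArray, val_newArray, AdjLists.size]
  rw [hlen] at h₂ h₄ ⊢
  have h₅ := Nat.zero_le (c * Fintype.card V)
  have h₆ := Nat.zero_le (∑ v, g.degree v)
  linarith

end

end Algo

/-! ### Adjacency lists -/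

namespace AdjLists

variable {V : Type}

lemma Represents.length_nodes [Fintype V] {g : AdjLists V} {G : ADMG V} (h : g.Represents G) :
    g.nodes.length = Fintype.card V := by
  classical
  rw [← List.toFinset_card_of_nodup h.nodup_nodes, ← Finset.card_univ]
  congr 1
  exact Finset.eq_univ_iff_forall.2 fun v => by simpa using h.mem_nodes v

lemma Represents.sum_map_nodes [Fintype V] {g : AdjLists V} {G : ADMG V} (h : g.Represents G)
    (f : V → ℕ) : (g.nodes.map f).sum = ∑ v, f v := by
  classical
  rw [← List.sum_toFinset f h.nodup_nodes]
  congr 1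
  exact Finset.eq_univ_iff_forall.2 fun v => by simpa using h.mem_nodes v

/-- Each edge occurs in at most `k` of the neighbour lists of a given type, if the edges `e u v` to
the neighbours `v` of `u` are distinct and each edge is incident to at most `k` nodes `u`. -/
lemma Represents.sum_length_le [Fintype V] {g : AdjLists V} {G : ADMG V} (h : g.Represents G)
    {ε : Type} [DecidableEq ε] (E : Finset ε) (e : V → V → ε) (n : Nbr) (k : ℕ)
    (he : ∀ u v, G.Adj u n v → e u v ∈ E) (hinj : ∀ u v v', e u v = e u v' → v = v')
    (inc : V → ε → Prop) [∀ u, DecidablePred (inc u)] (hinc : ∀ u v, inc u (e u v))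
    (hk : ∀ a ∈ E, (Finset.univ.filter fun u => inc u a).card ≤ k) :
    ∑ u, (g.nbrs n u).length ≤ k * E.card := by
  classical
  have h₁ : ∀ u ∈ (Finset.univ : Finset V),
      (g.nbrs n u).length ≤ (Finset.bipartiteAbove inc E u).card := by
    intro u _
    rw [← List.toFinset_card_of_nodup (h.nodup_nbrs n u)]
    refine Finset.card_le_card_of_injOn (e u) (fun v hv => ?_) fun v _ v' _ hvv' => hinj u v v' hvv'
    simp only [List.coe_toFinset, Set.mem_ofPred_eq, h.mem_nbrs] at hv
    simpa [Finset.bipartiteAbove, hinc] using he u v hv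
  refine (Finset.sum_le_sum h₁).trans ?_
  rw [Finset.sum_card_bipartiteAbove_eq_sum_card_bipartiteBelow, mul_comm]
  exact Finset.sum_le_card_nsmul E _ k hk

lemma Represents.size_le [Fintype V] {g : AdjLists V} {G : ADMG V} (h : g.Represents G) :
    g.size ≤ Fintype.card V + 2 * G.numEdges := by
  classical
  have hf := h.sum_length_le G.dirEdges (fun u v => (u, v)) .fwd 1 (fun u v huv => huv) (by simp)
    (fun u e => e.1 = u) (by simp)
    (fun a _ => by rw [Finset.filter_eq]; simp)
  have hb := h.sum_length_le G.dirEdges (fun u v => (v, u)) .bwd 1 (fun u v huv => huv) (by simp)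
    (fun u e => e.2 = u) (by simp)
    (fun a _ => by rw [Finset.filter_eq]; simp)
  have hi := h.sum_length_le G.biEdges (fun u v => s(u, v)) .bi 2 (fun u v huv => huv)
    (fun u v v' h => Sym2.congr_right.1 h) (fun u e => u ∈ e) (by simp)
    (fun a _ => by
      induction a with
      | h u v =>
        refine (Finset.card_le_card (t := {u, v}) fun w hw => ?_).trans Finset.card_le_two
        simpa using hw)
  simp only [size, degree, Nbr.sum_univ, Finset.sum_add_distrib, ADMG.numEdges]
  omega

lemma card_le_size [Fintype V] (g : AdjLists V) : Fintype.card V ≤ g.size :=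
  Nat.le_add_right _ _

lemma sum_length_le_size [Fintype V] (g : AdjLists V) (n : Nbr) :
    ∑ v, (g.nbrs n v).length + Fintype.card V ≤ g.size := by
  rw [size, add_comm]
  gcongr with v
  exact Finset.single_le_sum (f := fun n => (g.nbrs n v).length) (fun _ _ => Nat.zero_le _)
    (Finset.mem_univ n)

end AdjLists

/-! ### Correctness and cost of the subroutines -/

namespace Algo

open Timed Relation

section

variable {V : Type} {G : ADMG V} {g : AdjLists V}

/-- A search that only uses edges of the initial type `n₀` is a search in a relation on nodes. -/
lemma exists_reach_iff {φ : V × Nbr → V × Nbr → Timed Bool} {n₀ : Nbr} {r : V → V → Prop}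
    (h : ∀ s t, Trans g φ s t ↔ t.2 = n₀ ∧ r s.1 t.1) (u v : V) :
    (∃ n, ReflTransGen (Trans g φ) (u, n₀) (v, n)) ↔ ReflTransGen r u v := by
  constructor
  · rintro ⟨n, hn⟩
    exact ReflTransGen.lift (r := Trans g φ) (p := r) Prod.fst
      (fun s t hst => ((h s t).1 hst).2) _ _ hn
  · intro huv
    exact ⟨n₀, ReflTransGen.lift (fun v => (v, n₀))
      (fun s t hst => (h _ _).2 ⟨rfl, hst⟩) _ _ huv⟩

lemma exists_reach_iff_swap {φ : V × Nbr → V × Nbr → Timed Bool} {n₀ : Nbr} {r : V → V → Prop}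
    (h : ∀ s t, Trans g φ s t ↔ t.2 = n₀ ∧ r t.1 s.1) (u v : V) :
    (∃ n, ReflTransGen (Trans g φ) (u, n₀) (v, n)) ↔ ReflTransGen r v u := by
  rw [exists_reach_iff (r := Function.swap r) h, reflTransGen_swap]

lemma val_descendants [Fintype V] [DecidableEq V] (hg : g.Represents G) (X : List V) (v : V) :
    (descendants g X).val v = true ↔ v ∈ G.descendants {u | u ∈ X} := by
  rw [descendants, val_reach hg.mem_nodes hg.length_nodes]
  simp only [exists_reach_iff (g := g) (φ := fun _ t => isEq t.2 .fwd) (r := G.Dir) (n₀ := .fwd)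
    (fun s t => by
      simp only [Trans, hg.mem_nbrs, val_isEq, decide_eq_true_eq]
      constructor
      · rintro ⟨h, ht⟩
        exact ⟨ht, by simpa [ht, ADMG.Adj] using h⟩
      · rintro ⟨ht, h⟩
        exact ⟨by simpa [ht, ADMG.Adj] using h, ht⟩)]
  rfl

lemma val_ancestors [Fintype V] [DecidableEq V] (hg : g.Represents G) (X : List V) (v : V) :
    (ancestors g X).val v = true ↔ v ∈ G.ancestors {u | u ∈ X} := by
  rw [ancestors, val_reach hg.mem_nodes hg.length_nodes]
  simp only [exists_reach_iff_swap (g := g) (φ := fun _ t => isEq t.2 .bwd)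
    (r := G.Dir) (n₀ := .bwd) (fun s t => by
      simp only [Trans, hg.mem_nbrs, val_isEq, decide_eq_true_eq]
      constructor
      · rintro ⟨h, ht⟩
        exact ⟨ht, by simpa [ht, ADMG.Adj] using h⟩
      · rintro ⟨ht, h⟩
        exact ⟨by simpa [ht, ADMG.Adj] using h, ht⟩)]
  rfl

lemma val_properAncestors [Fintype V] [DecidableEq V] (hg : g.Represents G) {x y : V} (hxy : x ≠ y)
    (v : V) : (properAncestors g x [y]).val v = true ↔ v ∈ G.properAncestors {x} {y} := by
  rw [properAncestors, val_reach hg.mem_nodes hg.length_nodes]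
  simp only [exists_reach_iff_swap (g := g) (φ := fun _ t => do
      if ← isEq t.2 .bwd then
        let b ← isEq t.1 x
        return !b
      else
        return false)
    (r := fun u v => (u, v) ∈ G.dirEdges ∧ u ∉ ({x} : Set V)) (n₀ := .bwd)
    (fun s t => by
      obtain ⟨u, m⟩ := s
      obtain ⟨v, n⟩ := t
      simp only [Trans, hg.mem_nbrs, val_bind, val_isEq]
      cases n <;> simp [ADMG.Adj])]
  simp [ADMG.properAncestors, hxy.symm]

lemma val_causal [Fintype V] [DecidableEq V] (hg : g.Represents G) {x y : V} (hxy : x ≠ y)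
    (v : V) : (causal g x y).val v = true ↔ v ∈ G.causal x y := by
  simp only [causal, val_bind, val_tabulate hg.mem_nodes, val_read, val_step, Bool.and_eq_true,
    val_properAncestors hg hxy, val_descendants hg]
  simp [ADMG.causal]

lemma mem_forEach_cons {α : Type} {f : List α → α → Timed (List α)} {q : α → Bool}
    (hf : ∀ r u, (f r u).val = if q u = true then u :: r else r) (l r : List α) (u : α) :
    u ∈ (forEach l r f).val ↔ u ∈ r ∨ (u ∈ l ∧ q u = true) := by
  induction l generalizing r with
  | nil => simp
  | cons a l ih =>
    simp only [forEach_cons, val_bind, val_step, ih, hf, List.mem_cons]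
    split_ifs <;> grind

lemma length_forEach_cons_le {α : Type} {f : List α → α → Timed (List α)} {q : α → Bool}
    (hf : ∀ r u, (f r u).val = if q u = true then u :: r else r) (l r : List α) :
    (forEach l r f).val.length ≤ l.length + r.length := by
  induction l generalizing r with
  | nil => simp
  | cons a l ih =>
    simp only [forEach_cons, val_bind, val_step, List.length_cons]
    refine (ih _).trans ?_
    rw [hf]
    split_ifs
    · rw [List.length_cons]
      omega
    · omega

lemma nodup_forEach_cons {α : Type} {f : List α → α → Timed (List α)} {q : α → Bool}
    (hf : ∀ r u, (f r u).val = if q u = true then u :: r else r) (l r : List α)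
    (h : (l ++ r).Nodup) : (forEach l r f).val.Nodup := by
  induction l generalizing r with
  | nil => simpa using h
  | cons a l ih =>
    simp only [forEach_cons, val_bind, val_step, hf]
    refine ih _ ?_
    split_ifs
    · exact List.nodup_middle.2 h
    · exact (List.nodup_cons.1 h).2

lemma mem_elements (hg : g.Represents G) (S : V → Bool) (v : V) :
    v ∈ (elements g S).val ↔ S v = true := by
  rw [elements, mem_forEach_cons (q := S) (fun r u => by cases h : S u <;> simp [h])]
  simp [hg.mem_nodes]

lemma length_elements_le (g : AdjLists V) (S : V → Bool) :
    (elements g S).val.length ≤ g.nodes.length :=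
  length_forEach_cons_le (q := S) (fun r u => by cases h : S u <;> simp [h]) _ _

lemma mem_select (l : List V) (f : V → Timed Bool) (v : V) :
    v ∈ (select l f).val ↔ v ∈ l ∧ (f v).val = true := by
  rw [select, mem_forEach_cons (q := fun v => (f v).val)
    (fun r u => by cases h : (f u).val <;> simp [h])]
  simp

lemma nodup_select {l : List V} (hl : l.Nodup) (f : V → Timed Bool) :
    (select l f).val.Nodup :=
  nodup_forEach_cons (q := fun v => (f v).val)
    (fun r u => by cases h : (f u).val <;> simp [h]) _ _ (by simpa using hl)

lemma steps_select_le (l : List V) {f : V → Timed Bool} {c : ℕ} (hf : ∀ v, (f v).steps ≤ c) :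
    (select l f).steps ≤ l.length * (c + 2) + 1 := by
  refine (steps_forEach_le (c := c + 1) (fun r u => ?_) l []).trans (by linarith)
  have := hf u
  cases h : (f u).val <;> simp [h] <;> omega

lemma val_forb [Fintype V] [DecidableEq V] (hg : g.Represents G) {x y : V} {C : V → Bool}
    (hC : ∀ v, C v = true ↔ v ∈ G.causal x y) (v : V) :
    (forb g x C).val v = true ↔ v ∈ G.forb x y := by
  have h : {u | u ∈ (elements g C).val} = G.causal x y := by
    ext u
    simp [mem_elements hg, hC]
  simp only [forb, val_bind, val_write, Function.update_apply]
  split_ifs with hv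
  · simp [ADMG.forb, hv]
  · rw [val_descendants hg, h]
    simp [ADMG.forb, hv]

lemma represents_cutCausal [DecidableEq V] (hg : g.Represents G) {x y : V} {C : V → Bool}
    (hC : ∀ v, C v = true ↔ v ∈ G.causal x y) :
    (cutCausal g x C).val.Represents (G.cutCausal x y) := by
  have hfwd : ∀ v, (cutCausal g x C).val.nbrs .fwd v =
      (select (g.nbrs .fwd v) fun u => do
        let b ← isEq v x
        let c ← read C u
        step (!(b && c))).val := by
    intro v
    simp only [cutCausal, val_bind, val_pure]
    rw [val_forEach_write (fun a v => rfl), if_pos (hg.mem_nodes v)]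
    rfl
  have hbwd : ∀ v, (cutCausal g x C).val.nbrs .bwd v =
      (select (g.nbrs .bwd v) fun u => do
        let b ← isEq u x
        let c ← read C v
        step (!(b && c))).val := by
    intro v
    simp only [cutCausal, val_bind, val_pure]
    rw [val_forEach_write (fun a v => rfl), if_pos (hg.mem_nodes v)]
    rfl
  have hbi : ∀ v, (cutCausal g x C).val.nbrs .bi v = g.nbrs .bi v := fun _ => rfl
  refine ⟨hg.nodup_nodes, hg.mem_nodes, fun n v => ?_, fun n v u => ?_⟩
  · cases n
    · rw [hfwd]
      exact nodup_select (hg.nodup_nbrs _ _) _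
    · rw [hbwd]
      exact nodup_select (hg.nodup_nbrs _ _) _
    · exact hg.nodup_nbrs _ _
  · rw [ADMG.cutCausal_adj_iff]
    cases n
    · rw [hfwd, mem_select, hg.mem_nbrs]
      simp [← hC]
      tauto
    · rw [hbwd, mem_select, hg.mem_nbrs]
      simp [← hC]
      tauto
    · rw [hbi, hg.mem_nbrs]
      simp

lemma val_dConnected [Fintype V] [DecidableEq V] (hg : g.Represents G) (x : V) (Z : V → Bool)
    (v : V) : (dConnected g x Z).val v = true ↔ G.DConn {u | Z u = true} x v := by
  have h : ∀ s t, Trans g (fun s t => do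
      let b ← read Z s.1
      if ← step (s.2.collider t.2) then return b else return !b) s t ↔
      G.Step {u | Z u = true} {u | Z u = true} s t := by
    intro s t
    simp only [Trans, hg.mem_nbrs, ADMG.Step, val_bind, val_read, val_step]
    cases s.2.collider t.2 <;> simp
  rw [dConnected, val_reach hg.mem_nodes hg.length_nodes]
  simp only [show Trans g _ = _ from funext fun s => funext fun t => propext (h s t),
    List.mem_singleton, exists_eq_left]
  rfl

lemma val_closure [Fintype V] [DecidableEq V] (hg : g.Represents G) (x : V) (Z A : V → Bool)
    (v : V) : (closure g x Z A).val v = true ↔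
      v ∈ G.closure x {u | Z u = true} {u | A u = true} := by
  have h : ∀ s t, Trans g (fun s t => do
      let a ← read A t.1
      if ← step (s.2.collider t.2) then
        return a
      else
        let b ← read Z s.1
        step (a && !b)) s t ↔
      G.ClosureStep {u | Z u = true} {u | A u = true} s t := by
    intro s t
    simp only [Trans, hg.mem_nbrs, ADMG.ClosureStep, val_bind, val_read, val_step]
    cases s.2.collider t.2 <;> simp
  rw [closure, val_reach hg.mem_nodes hg.length_nodes]
  simp only [show Trans g _ = _ from funext fun s => funext fun t => propext (h s t),
    List.mem_singleton, exists_eq_left]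
  rfl

/-- The subroutine returns `none` if the closure reaches `b`, and its intersection with `Z₀`
otherwise. -/
lemma val_nearestSeparator [Fintype V] [DecidableEq V] (hg : g.Represents G) (a b : V)
    {R : V → Bool} {Z₀ A : Set V} (hA : A = G.ancestors {a, b})
    (hZ₀ : Z₀ = ({v | R v = true} \ {a, b}) ∩ A) :
    (b ∈ G.closure a Z₀ A → (nearestSeparator g a b R).val = none) ∧
      (b ∉ G.closure a Z₀ A → ∃ W, (nearestSeparator g a b R).val = some W ∧
        {v | W v = true} = Z₀ ∩ G.closure a Z₀ A) := by
  have hA' : {u | (ancestors g [a, b]).val u = true} = A := by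
    ext u
    rw [hA, Set.mem_ofPred_eq, val_ancestors hg]
    simp [ADMG.ancestors]
  obtain ⟨Z, hZ⟩ : ∃ Z : V → Bool, Z = (tabulate g fun v => do
    let r ← read R v
    let c ← read (ancestors g [a, b]).val v
    let d ← isEq v a
    let e ← isEq v b
    step (r && c && !d && !e)).val := ⟨_, rfl⟩
  have hZ' : {u | Z u = true} = Z₀ := by
    ext u
    rw [Set.mem_ofPred_eq, hZ, val_tabulate hg.mem_nodes, hZ₀, ← hA']
    simp
    tauto
  have hS : ∀ v, (closure g a Z (ancestors g [a, b]).val).val v = true ↔ v ∈ G.closure a Z₀ A := by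
    intro v
    rw [val_closure hg, hA', hZ']
  constructor
  · intro hb
    have hb' : (read (closure g a Z (ancestors g [a, b]).val).val b).val = true := (hS b).2 hb
    simp only [nearestSeparator, val_bind, ← hZ]
    rw [if_pos hb', val_pure]
  · intro hb
    have hb' : ¬ (read (closure g a Z (ancestors g [a, b]).val).val b).val = true :=
      mt (hS b).1 hb
    refine ⟨(tabulate g fun v => do
      let c ← read Z v
      let d ← read (closure g a Z (ancestors g [a, b]).val).val v
      step (c && d)).val, ?_, ?_⟩
    · simp only [nearestSeparator, val_bind, ← hZ]
      rw [if_neg hb']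
      rfl
    · ext v
      have hv : v ∈ Z₀ ↔ Z v = true := by
        rw [← hZ']
        rfl
      rw [Set.mem_ofPred_eq, val_tabulate hg.mem_nodes]
      simp [hS, hv]

lemma val_tryAll_cons [DecidableEq V] (g g' : AdjLists V) (x y : V) (F R : V → Bool) (z : V)
    (l : List V) : (tryAll g g' x y F R (z :: l)).val =
      if F z = true ∨ z = y then (tryAll g g' x y F R l).val else
        match (nearestSeparator g' y z R).val with
        | none => (tryAll g g' x y F R l).val
        | some W => if (dConnected g x W).val z = true then some (z, W) else
            (tryAll g g' x y F R l).val := by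
  change (if (F z || decide (z = y)) = true then _ else _ : Timed _).val = _
  by_cases h : F z = true ∨ z = y
  · rw [if_pos h, if_pos (by simpa using h)]
  · rw [if_neg h, if_neg (by simpa using h), val_bind, val_step]
    cases (nearestSeparator g' y z R).val with
    | none => rfl
    | some W =>
      change (if (dConnected g x W).val z = true then _ else _ : Timed _).val = _
      dsimp only
      split_ifs <;> rfl

lemma steps_tryAll_cons [DecidableEq V] (g g' : AdjLists V) (x y : V) (F R : V → Bool) (z : V)
    (l : List V) : (tryAll g g' x y F R (z :: l)).steps =
      1 + (1 + (1 + if F z = true ∨ z = y then (tryAll g g' x y F R l).steps else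
        (nearestSeparator g' y z R).steps + match (nearestSeparator g' y z R).val with
        | none => (tryAll g g' x y F R l).steps
        | some W => (dConnected g x W).steps + (1 + if (dConnected g x W).val z = true then 0 else
            (tryAll g g' x y F R l).steps))) := by
  change 1 + (1 + (1 + (if (F z || decide (z = y)) = true then _ else _ : Timed _).steps)) = _
  by_cases h : F z = true ∨ z = y
  · rw [if_pos h, if_pos (by simpa using h)]
  · rw [if_neg h, if_neg (by simpa using h), steps_bind, val_step]
    cases (nearestSeparator g' y z R).val with
    | none => rfl
    | some W =>
      change _ + (_ + (_ + (_ + ((_ + (_ +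
        (if (dConnected g x W).val z = true then _ else _ : Timed _).steps)))))) = _
      dsimp only
      split_ifs <;> rfl

/-- If the main loop fails, every candidate that has a nearest separator is d-separated from `x`. -/
lemma tryAll_none [DecidableEq V] {g g' : AdjLists V} {x y : V} {F R : V → Bool} {l : List V}
    (h : (tryAll g g' x y F R l).val = none) {z : V} (hz : z ∈ l) (hF : F z = false) (hzy : z ≠ y)
    {W : V → Bool} (hW : (nearestSeparator g' y z R).val = some W) :
    (dConnected g x W).val z = false := by
  induction l with
  | nil => simp at hz
  | cons u l ih =>
    rw [val_tryAll_cons] at h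
    rcases List.mem_cons.1 hz with rfl | hz'
    · rw [if_neg (by simp [hF, hzy]), hW] at h
      dsimp only at h
      by_contra hD
      rw [if_pos (by simpa using hD)] at h
      cases h
    · refine ih ?_ hz'
      split_ifs at h with h₁
      · exact h
      · split at h
        · exact h
        · split_ifs at h
          exact h

lemma tryAll_some [DecidableEq V] {g g' : AdjLists V} {x y z : V} {F R W : V → Bool} {l : List V}
    (h : (tryAll g g' x y F R l).val = some (z, W)) :
    F z = false ∧ z ≠ y ∧ (nearestSeparator g' y z R).val = some W ∧
      (dConnected g x W).val z = true := by
  induction l with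
  | nil => cases h
  | cons u l ih =>
    rw [val_tryAll_cons] at h
    split_ifs at h with h₁
    · exact ih h
    · split at h
      · exact ih h
      · rename_i W' hW'
        split_ifs at h with h₂
        · cases h
          simp only [not_or, Bool.not_eq_true] at h₁
          exact ⟨h₁.1, h₁.2, hW', h₂⟩
        · exact ih h

/-! ### Running time -/

lemma steps_reach_le_size [Fintype V] [DecidableEq V] (hg : g.Represents G) (X : List V) (n₀ : Nbr)
    {φ : V × Nbr → V × Nbr → Timed Bool} (hφ : ∀ s t, (φ s t).steps ≤ 4) :
    (reach g X n₀ φ).steps ≤ 55 * g.size + 4 * X.length + 3 :=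
  steps_reach_le hg.length_nodes X n₀ hφ

lemma steps_descendants_le [Fintype V] [DecidableEq V] (hg : g.Represents G) (X : List V) :
    (descendants g X).steps ≤ 55 * g.size + 4 * X.length + 3 :=
  steps_reach_le_size hg X _ fun s t => by simp

lemma steps_ancestors_le [Fintype V] [DecidableEq V] (hg : g.Represents G) (X : List V) :
    (ancestors g X).steps ≤ 55 * g.size + 4 * X.length + 3 :=
  steps_reach_le_size hg X _ fun s t => by simp

lemma steps_properAncestors_le [Fintype V] [DecidableEq V] (hg : g.Represents G) (x : V)
    (X : List V) : (properAncestors g x X).steps ≤ 55 * g.size + 4 * X.length + 3 :=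
  steps_reach_le_size hg X _ fun s t => by
    simp only [steps_bind]
    split_ifs <;> simp

lemma steps_dConnected_le [Fintype V] [DecidableEq V] (hg : g.Represents G) (x : V)
    (Z : V → Bool) : (dConnected g x Z).steps ≤ 55 * g.size + 7 :=
  steps_reach_le_size hg [x] _ fun s t => by
    simp only [steps_bind]
    split_ifs <;> simp

lemma steps_closure_le [Fintype V] [DecidableEq V] (hg : g.Represents G) (x : V)
    (Z A : V → Bool) : (closure g x Z A).steps ≤ 55 * g.size + 7 :=
  steps_reach_le_size hg [x] _ fun s t => by
    simp only [steps_bind]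
    split_ifs <;> simp

lemma steps_nearestSeparator_le [Fintype V] [DecidableEq V] (hg : g.Represents G) (a b : V)
    (R : V → Bool) : (nearestSeparator g a b R).steps ≤ 124 * g.size + 21 := by
  have h₁ := steps_ancestors_le hg [a, b]
  have h₂ : ∀ A : V → Bool, (tabulate g fun v => do
      let r ← read R v
      let c ← read A v
      let d ← isEq v a
      let e ← isEq v b
      step (r && c && !d && !e)).steps ≤ g.nodes.length * (5 + 3) + 1 :=
    fun A => steps_tabulate_le fun v => by simp
  have h₃ : ∀ Z S : V → Bool, (tabulate g fun v => do
      let c ← read Z v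
      let d ← read S v
      step (c && d)).steps ≤ g.nodes.length * (3 + 3) + 1 :=
    fun Z S => steps_tabulate_le fun v => by simp
  have hp := AdjLists.card_le_size g
  rw [hg.length_nodes] at h₂ h₃
  simp only [nearestSeparator, steps_bind]
  generalize (ancestors g [a, b]).val = A
  specialize h₂ A
  generalize (tabulate g fun v => do
      let r ← read R v
      let c ← read A v
      let d ← isEq v a
      let e ← isEq v b
      step (r && c && !d && !e)) = Z at *
  have h₄ := steps_closure_le hg a Z.val A
  have h₅ := h₃ Z.val (closure g a Z.val A).val
  simp only [List.length_cons, List.length_nil] at h₁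
  split_ifs
  · simp only [steps_read, steps_pure]
    omega
  · simp only [steps_bind, steps_read, steps_pure]
    omega

lemma steps_causal_le [Fintype V] [DecidableEq V] (hg : g.Represents G) (x y : V) :
    (causal g x y).steps ≤ 116 * g.size + 15 := by
  have h₁ := steps_properAncestors_le hg x [y]
  have h₂ := steps_descendants_le hg [x]
  have h₃ : ∀ a d : V → Bool, (tabulate g fun v => do
      let b ← read a v
      let c ← read d v
      step (b && c)).steps ≤ g.nodes.length * (3 + 3) + 1 :=
    fun _ _ => steps_tabulate_le fun v => by simp
  have h₄ := h₃ (properAncestors g x [y]).val (descendants g [x]).val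
  have hp := AdjLists.card_le_size g
  rw [hg.length_nodes] at h₄
  simp only [causal, steps_bind]
  simp only [List.length_cons, List.length_nil] at h₁ h₂
  omega

lemma steps_forb_le [Fintype V] [DecidableEq V] (hg : g.Represents G) (x : V) (C : V → Bool) :
    (forb g x C).steps ≤ 62 * g.size + 5 := by
  have h₁ : (elements g C).steps ≤ g.nodes.length * (2 + 1) + 1 :=
    steps_forEach_le (fun l v => by
      simp only [steps_bind]
      split_ifs <;> simp) _ _
  have h₂ := steps_descendants_le hg (elements g C).val
  have h₃ := length_elements_le g C
  have hp := AdjLists.card_le_size g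
  rw [hg.length_nodes] at h₁ h₃
  simp only [forb, steps_bind, steps_write]
  omega

lemma steps_cutCausal_le [Fintype V] [DecidableEq V] (hg : g.Represents G) (x : V)
    (C : V → Bool) : (cutCausal g x C).steps ≤ 12 * g.size + 2 := by
  have h : ∀ (n : Nbr) (q : V → V → Timed Bool), (∀ v u, (q v u).steps ≤ 3) →
      ∀ a : V → List V, (forEach g.nodes a fun a v => do
        let l ← read (g.nbrs n) v
        let l ← select l (q v)
        write a v l).steps ≤ 5 * g.size + 1 := by
    intro n q hq a
    refine (steps_forEach_le_sum (c := fun v => (g.nbrs n v).length * 5 + 3) (fun a v => ?_)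
      _ _).trans ?_
    · have := steps_select_le (g.nbrs n v) (hq v)
      simp only [steps_bind, steps_read, val_read, steps_write]
      omega
    · have := AdjLists.sum_length_le_size g n
      rw [hg.sum_map_nodes, Finset.sum_add_distrib, ← Finset.sum_mul, hg.length_nodes]
      simp only [Finset.sum_const, Finset.card_univ, smul_eq_mul]
      omega
  have hp := AdjLists.card_le_size g
  have h₁ := h .fwd (fun v u => do
      let b ← isEq v x
      let c ← read C u
      step (!(b && c))) (fun v u => by simp) (fun _ => [])
  have h₂ := h .bwd (fun v u => do
      let b ← isEq u x
      let c ← read C v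
      step (!(b && c))) (fun v u => by simp) (fun _ => [])
  simp only [cutCausal, steps_bind, steps_newArray, val_newArray, steps_pure, hg.length_nodes] at *
  omega

lemma steps_tryAll_le [DecidableEq V] {g g' : AdjLists V} {x y : V} {F R : V → Bool} {c d : ℕ}
    (hc : ∀ z, (nearestSeparator g' y z R).steps ≤ c) (hd : ∀ W, (dConnected g x W).steps ≤ d)
    (l : List V) : (tryAll g g' x y F R l).steps ≤ l.length * (c + d + 4) + 1 := by
  induction l with
  | nil =>
    change 1 ≤ _
    omega
  | cons z l ih =>
    have h₁ := hc z
    rw [steps_tryAll_cons, List.length_cons, Nat.succ_mul]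
    split_ifs
    · omega
    · split
      · omega
      · rename_i W _
        have h₂ := hd W
        split_ifs <;> linarith

lemma steps_findInstrument_le [Fintype V] [DecidableEq V] (hg : g.Represents G) (x y : V)
    (hxy : x ≠ y) : (findInstrument g x y).steps ≤
      1000 * (Fintype.card V * (Fintype.card V + G.numEdges)) := by
  have h₁ := steps_causal_le hg x y
  have hC := val_causal hg hxy
  have hs : g.size ≤ Fintype.card V + 2 * G.numEdges := hg.size_le
  simp only [findInstrument, steps_bind]
  generalize (causal g x y).val = C at *
  have h₂ := steps_forb_le hg x C
  have h₃ : ∀ F : V → Bool, (tabulate g fun v => do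
      let b ← read F v
      step (!b)).steps ≤ g.nodes.length * (2 + 3) + 1 :=
    fun _ => steps_tabulate_le fun v => by simp
  have h₄ := h₃ (forb g x C).val
  have h₅ := steps_cutCausal_le hg x C
  have hg' := represents_cutCausal hg hC
  have hs' : (cutCausal g x C).val.size ≤ Fintype.card V + 2 * G.numEdges := by
    refine hg'.size_le.trans ?_
    have : (G.cutCausal x y).dirEdges.card ≤ G.dirEdges.card :=
      Finset.card_le_card fun e he => ((ADMG.cutCausal_adj_iff (u := e.1) (n := .fwd)).1 he).1
    have : (G.cutCausal x y).biEdges = G.biEdges := rfl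
    simp only [ADMG.numEdges, this]
    omega
  have h₆ := steps_tryAll_le (F := (forb g x C).val) (x := x) (g := g) (R := (tabulate g fun v => do
      let b ← read (forb g x C).val v
      step (!b)).val)
    (fun z => steps_nearestSeparator_le hg' y z _) (fun W => steps_dConnected_le hg x W) g.nodes
  have hp : 1 ≤ Fintype.card V := Fintype.card_pos_iff.2 ⟨x⟩
  rw [hg.length_nodes] at h₄ h₆
  have h₇ : Fintype.card V * (124 * (cutCausal g x C).val.size + 21 + (55 * g.size + 7) + 4) ≤
      Fintype.card V * (211 * Fintype.card V + 358 * G.numEdges) :=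
    Nat.mul_le_mul_left _ (by omega)
  -- the linear terms are absorbed by `p * (p + m)` since `1 ≤ p`
  nlinarith [Nat.zero_le G.numEdges, Nat.mul_le_mul_right (Fintype.card V) hp,
    Nat.mul_le_mul_right G.numEdges hp]

end

end Algo

/-! ### The algorithm finds an instrument if there is one -/

section

open Algo Timed

variable {V : Type} [Fintype V] [DecidableEq V] {G : ADMG V} {g : AdjLists V}

/-- The main loop is run with the forbidden nodes in `F`, the non-forbidden ones in `R` and the cut
graph in `g'`. -/
lemma findInstrument_eq_tryAll (hg : g.Represents G) {x y : V} (hxy : x ≠ y) :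
    ∃ (g' : AdjLists V) (F R : V → Bool), g'.Represents (G.cutCausal x y) ∧
      (∀ v, F v = true ↔ v ∈ G.forb x y) ∧ {v | R v = true} = (G.forb x y)ᶜ ∧
      (findInstrument g x y).val = (tryAll g g' x y F R g.nodes).val := by
  have hF := val_forb hg (val_causal hg hxy)
  refine ⟨_, _, _, represents_cutCausal hg (val_causal hg hxy), hF, ?_, rfl⟩
  ext v
  rw [Set.mem_ofPred_eq, val_tabulate hg.mem_nodes, Set.mem_compl_iff, ← hF]
  simp

lemma val_findInstrument_some (hg : g.Represents G) {x y z : V} (hxy : x ≠ y) {S : V → Bool}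
    (h : (findInstrument g x y).val = some (z, S)) :
    G.IsValidCIS x y {z} {v | S v = true} ∧
      (G.cutCausal x y).IsNearestSeparator y z (G.forb x y ∪ {y, z})ᶜ {v | S v = true} := by
  obtain ⟨g', F, R, hg', hF, hR, heq⟩ := findInstrument_eq_tryAll hg hxy
  obtain ⟨hFz, hzy, hsome, hD⟩ := tryAll_some (heq ▸ h)
  have hzF : z ∉ G.forb x y := by
    rw [← hF, hFz]
    exact Bool.false_ne_true
  have hRR : {v | R v = true} \ {y, z} = (G.forb x y ∪ {y, z})ᶜ := by
    rw [hR, Set.compl_union, Set.sdiff_eq]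
  obtain ⟨hnone, hW⟩ := val_nearestSeparator hg' y z (R := R) rfl rfl
  rw [hRR] at hnone hW
  have hclo := fun hmem => Option.some_ne_none S (hsome.symm.trans (hnone hmem))
  obtain ⟨W, hWsome, hWeq⟩ := hW hclo
  obtain rfl : S = W := Option.some.inj (hsome.symm.trans hWsome)
  have hyR : y ∉ (G.forb x y ∪ {y, z})ᶜ := by simp
  have hnear := ADMG.isNearestSeparator_closure hyR hclo
  rw [← hWeq] at hnear
  have hSR : ∀ v ∈ {v | S v = true}, v ∉ G.forb x y ∪ {y, z} := fun v hv => (hnear.subset hv).1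
  have hyS : y ∉ {v | S v = true} := fun h => hSR y h (by simp)
  refine ⟨(ADMG.isValidCIS_singleton_iff hxy).2 ⟨hzF, hzy, fun h => hSR z h (by simp), hyS,
    Set.disjoint_left.2 fun v hv hvF => hSR v hv (.inl hvF), (val_dConnected hg x S z).1 hD,
    (ADMG.dSep_singleton_iff hyS).1 hnear.dSep⟩, hnear⟩

lemma val_findInstrument_ne_none (hg : g.Represents G) {x y z : V} {W : Set V}
    (h : G.IsValidCIS x y {z} W) : (findInstrument g x y).val ≠ none := by
  intro hnone
  obtain ⟨g', F, R, hg', hF, hR, heq⟩ := findInstrument_eq_tryAll hg h.ne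
  obtain ⟨z, hzF, hzy, A, Z₀, hA, hZ₀, hclo, hconn⟩ := h.exists_closure
  obtain ⟨S, hS, hSeq⟩ := (val_nearestSeparator hg' y z (R := R) hA
    (by rw [hZ₀, hR, Set.compl_union, Set.sdiff_eq])).2 hclo
  have hD := tryAll_none (heq ▸ hnone) (hg.mem_nodes z)
    (by rw [← Bool.not_eq_true, hF]; exact hzF) hzy hS
  rw [← hSeq] at hconn
  rw [(val_dConnected hg x S z).2 hconn] at hD
  cases hD

end

theorem mainTheorem6 :
    ∃ K : ℕ, ∀ (V : Type) [Fintype V] [DecidableEq V] (G : ADMG V) (g : AdjLists V),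
      g.Represents G → ∀ x y : V, x ≠ y →
        ((∃ (z : V) (W : Set V), G.IsValidCIS x y {z} W) →
          ∃ (z : V) (S : V → Bool), (Algo.findInstrument g x y).val = some (z, S) ∧
            G.IsValidCIS x y {z} {v | S v = true} ∧
            (G.cutCausal x y).IsNearestSeparator y z (G.forb x y ∪ {y, z})ᶜ {v | S v = true}) ∧
        ((¬ ∃ (z : V) (W : Set V), G.IsValidCIS x y {z} W) →
          (Algo.findInstrument g x y).val = none) ∧
        (Algo.findInstrument g x y).steps ≤
          K * (Fintype.card V * (Fintype.card V + G.numEdges)) := by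
  refine ⟨1000, fun V _ _ G g hg x y hxy => ⟨?_, ?_, Algo.steps_findInstrument_le hg x y hxy⟩⟩
  · rintro ⟨z, W, h⟩
    obtain ⟨⟨z', S⟩, hS⟩ := Option.ne_none_iff_exists'.1 (val_findInstrument_ne_none hg h)
    exact ⟨z', S, hS, val_findInstrument_some hg hxy hS⟩
  · intro h
    by_contra hne
    obtain ⟨⟨z, S⟩, hS⟩ := Option.ne_none_iff_exists'.1 hne
    exact h ⟨z, _, (val_findInstrument_some hg hxy hS).1⟩
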